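/- For an integer $D<0$ let $h(D)$ be the Gauss class number: the number of $\mathrm{SL}_2(\mathbb{Z})$-equivalence classes of primitive positive definite integral binary quadratic forms $ax^2+bxy+cy^2$ of discriminant $b^2-4ac=D$ (so $h(D)=0$ if $D\equiv 2,3 \pmod 4$). Let $$A=\prod_{p\ \mathrm{prime}}\left(1+\frac{p}{(p+1)^2(p-1)}\right).$$ Let $P$ be an odd prime and let $X>0$, $Y\ge 1$ be real numbers with $Y=o(X)$. Then, as $X\to\infty$, for every $\varepsilon>0$, $$\frac{\zeta(2)\pi}{XY}\sum_{\substack{N\in[X,X+Y]\\ P\nmid N\\ N\ \text{square-free}}}\left(\frac{h(-P^2N)}{2}+\frac{h(-N)}{2}+\frac{h(-4P^2N)}{2}+\frac{h(-4N)}{2}\right)=\frac{AP}{\sqrt X}+O_\varepsilon\!\left(\left(\frac1{\sqrt X}+\frac{P^{7/6}X^{1/12}}{Y^{5/6}}+\frac{PY}{X^{3/2}}\right)(PXY)^{\varepsilon}\right),$$ where the implied constant depends only on $\varepsilon$ (and not on $P$, $X$, $Y$). That is, for every $\varepsilon>0$ there is a constant $C>0$ such that, whenever $P$, $X$, $Y$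 vary in such a way that $P$ is always an odd prime, $Y\ge 1$, $X\to\infty$ and $Y=o(X)$, the difference of the left side and $AP/\sqrt X$ is eventually at most $C$ times the quantity inside $O_\varepsilon(\cdot)$ in absolute value. -/

import Mathlib

open Filter Asymptotics

/-- An integral binary quadratic form `a x² + b x y + c y²`. -/
@[ext]
structure BinForm where
  a : ℤ
  b : ℤ
  c : ℤ

namespace BinForm

/-- The value `a x² + b x y + c y²`. -/
def eval (f : BinForm) (x y : ℤ) : ℤ := f.a * x ^ 2 + f.b * x * y + f.c * y ^ 2

/-- The discriminant `b² - 4 a c`. -/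
def disc (f : BinForm) : ℤ := f.b ^ 2 - 4 * f.a * f.c

/-- The coefficients have no common divisor other than `±1`. -/
def IsPrimitive (f : BinForm) : Prop :=
  ∀ d : ℤ, d ∣ f.a → d ∣ f.b → d ∣ f.c → IsUnit d

/-- The form takes positive values at all nonzero integer vectors. -/
def IsPosDef (f : BinForm) : Prop :=
  ∀ x y : ℤ, (x, y) ≠ (0, 0) → 0 < f.eval x y

/-- The substitution `(x, y) ↦ (p x + q y, r x + s y)` applied to a form, where
`p, q, r, s` are the entries of `γ ∈ SL₂(ℤ)`. -/
def subst (f : BinForm) (γ : Matrix.SpecialLinearGroup (Fin 2) ℤ) : BinForm where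
  a := f.a * γ.1 0 0 ^ 2 + f.b * γ.1 0 0 * γ.1 1 0 + f.c * γ.1 1 0 ^ 2
  b := 2 * f.a * γ.1 0 0 * γ.1 0 1 + f.b * (γ.1 0 0 * γ.1 1 1 + γ.1 0 1 * γ.1 1 0)
    + 2 * f.c * γ.1 1 0 * γ.1 1 1
  c := f.a * γ.1 0 1 ^ 2 + f.b * γ.1 0 1 * γ.1 1 1 + f.c * γ.1 1 1 ^ 2

theorem eval_subst (f : BinForm) (γ : Matrix.SpecialLinearGroup (Fin 2) ℤ) (x y : ℤ) :
    (f.subst γ).eval x y =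
      f.eval (γ.1 0 0 * x + γ.1 0 1 * y) (γ.1 1 0 * x + γ.1 1 1 * y) := by
  simp only [eval, subst]; ring

theorem subst_one (f : BinForm) : f.subst 1 = f := by
  ext <;> simp [subst]

theorem subst_subst (f : BinForm) (γ δ : Matrix.SpecialLinearGroup (Fin 2) ℤ) :
    (f.subst γ).subst δ = f.subst (γ * δ) := by
  ext <;> simp [subst, Matrix.mul_apply, Fin.sum_univ_two] <;> ring

/-- Proper equivalence: two forms are equivalent when some substitution in `SL₂(ℤ)` carries
one to the other. -/
def properEquiv : Setoid BinForm where
  r f g := ∃ γ : Matrix.SpecialLinearGroup (Fin 2) ℤ, g = f.subst γ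
  iseqv :=
    { refl := fun f => ⟨1, (subst_one f).symm⟩
      symm := by
        rintro f g ⟨γ, rfl⟩
        exact ⟨γ⁻¹, by rw [subst_subst, mul_inv_cancel, subst_one]⟩
      trans := by
        rintro f g k ⟨γ, rfl⟩ ⟨δ, rfl⟩
        exact ⟨γ * δ, subst_subst f γ δ⟩ }

end BinForm

/-- Primitive positive definite integral binary quadratic forms of discriminant `D`. -/
def PrimPosForm (D : ℤ) : Type :=
  {f : BinForm // f.disc = D ∧ f.IsPrimitive ∧ f.IsPosDef}

/-- `SL₂(ℤ)`-equivalence of primitive positive definite forms of discriminant `D`. -/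
def primPosSetoid (D : ℤ) : Setoid (PrimPosForm D) :=
  BinForm.properEquiv.comap Subtype.val

/-- The Gauss class number `h(D)`: the number of `SL₂(ℤ)`-classes of primitive positive definite
integral binary quadratic forms of discriminant `D`. It is `0` when `D ≡ 2, 3 (mod 4)`, as
there are no forms of such a discriminant. -/
noncomputable def gaussClassNumber (D : ℤ) : ℕ :=
  Nat.card (Quotient (primPosSetoid D))

/-- The constant `A = ∏_p (1 + p / ((p + 1)² (p - 1)))`, over all primes `p`. -/
noncomputable def constA : ℝ :=
  ∏' p : Nat.Primes, (1 + (p : ℝ) / (((p : ℝ) + 1) ^ 2 * ((p : ℝ) - 1)))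

/-- The product that defines `constA` converges. -/
theorem multipliable_constA :
    Multipliable (fun p : Nat.Primes => (1 + (p : ℝ) / (((p : ℝ) + 1) ^ 2 * ((p : ℝ) - 1)))) := by
  apply Real.multipliable_one_add_of_summable
  have h : Summable (fun p : Nat.Primes => 2 / ((p:ℕ):ℝ)^2) := by
    have := (Real.summable_one_div_nat_pow.mpr (show 1 < 2 by norm_num)).mul_left 2
    have h2 := this.comp_injective (Nat.Primes.coe_nat_injective)
    refine h2.congr fun p => ?_
    simp [Function.comp]; ring
  refine Summable.of_nonneg_of_le (fun p => ?_) (fun p => ?_) h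
  · have : (2:ℝ) ≤ p := by exact_mod_cast p.2.two_le
    have : (0:ℝ) ≤ (p:ℝ) - 1 := by linarith
    positivity
  · have h2 : (2:ℝ) ≤ p := by exact_mod_cast p.2.two_le
    have h3 : (0:ℝ) < (p:ℝ) - 1 := by linarith
    rw [div_le_div_iff₀ (by positivity) (by positivity)]
    nlinarith [sq_nonneg ((p:ℝ)), mul_pos h3 (by positivity : (0:ℝ) < p), mul_pos (mul_pos h3 h3) (by positivity : (0:ℝ) < p)]

open Classical in
/-- The square-free positive integers `N ∈ [X, X + Y]` not divisible by `P`
(for real `X > 0` and `Y ≥ 0`). -/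
noncomputable def levels (P : ℕ) (X Y : ℝ) : Finset ℕ :=
  {N ∈ Finset.Icc ⌈X⌉₊ ⌊X + Y⌋₊ | Squarefree N ∧ ¬ P ∣ N}

/-- The normalised sum of class numbers
`(ζ(2) π / (X Y)) ∑_N (h(-P²N) + h(-N) + h(-4P²N) + h(-4N)) / 2`. -/
noncomputable def classNumberAverage (P : ℕ) (X Y : ℝ) : ℝ :=
  (riemannZeta 2).re * Real.pi / (X * Y) *
    ∑ N ∈ levels P X Y,
      ((gaussClassNumber (-((P : ℤ) ^ 2 * N)) : ℝ) / 2 + (gaussClassNumber (-(N : ℤ)) : ℝ) / 2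
        + (gaussClassNumber (-(4 * (P : ℤ) ^ 2 * N)) : ℝ) / 2
        + (gaussClassNumber (-(4 * (N : ℤ))) : ℝ) / 2)

/-! The average is obtained by counting reduced forms; no `L`-functions enter. Passing from
discriminant `D` to `P²D` multiplies the number of classes by roughly `P`: for `P ∤ D` each strictly
reduced form of discriminant `D` yields at least `P - 2` classes (`le_gaussClassNumber_level`), and
each reduced form accounts for at most `P + 1` (`gaussClassNumber_level_le`). For square-free `N`,
discriminants `-4N` and `-N` together amount to the forms `ax² + 2βxy + cy²` with `ac - β² = N`. So
the contribution of `N` lies between `(P ∓ 2)/2` times a count of such forms, strictly reduced below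
and reduced above (`le_levelSum`, `levelSum_le`). The loss `∓2` becomes the error `1/√X`.

As `(a, β)` determines `c`, one counts pairs with `a ∣ N + β²`. Square-freeness is detected by `∑
μ(d)` over `d² ∣ N`. For fixed `a` and square-free `d`, each `β` divisible by `gcd(a, d)` leaves one
class of `N` modulo `lcm(a, d²)`, and summing over `a` gives the main term `(π/3) Y σ · sqDensity d`
with `σ ≈ √X` (`abs_sum_pairCount_sub_le`). This serves for `d ≤ R = X^(1/12) Y^(1/6)`, at a cost of
`X^(1+ε)` for each `d`; larger `d` are handled by the divisor bound for `N + β²`. The total error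
`X^(1+ε) R`, divided by `XY`, gives `X^(1/12) / Y^(5/6)`. Finally `∑ μ(d) sqDensity d` has an Euler
product equal to `A / ζ(2)²` (`constA_eq`). -/

namespace BinForm

/-! ### Substitutions and reduction theory -/

/-- The substitution `(x, y) ↦ (p x + q y, r x + s y)` for an arbitrary integral matrix. -/
def act (f : BinForm) (p q r s : ℤ) : BinForm where
  a := f.a * p ^ 2 + f.b * p * r + f.c * r ^ 2
  b := 2 * f.a * p * q + f.b * (p * s + q * r) + 2 * f.c * r * s
  c := f.a * q ^ 2 + f.b * q * s + f.c * s ^ 2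

theorem act_act (f : BinForm) (p q r s p' q' r' s' : ℤ) :
    (f.act p q r s).act p' q' r' s' =
      f.act (p * p' + q * r') (p * q' + q * s') (r * p' + s * r') (r * q' + s * s') := by
  ext <;> simp only [act] <;> ring

theorem act_one (f : BinForm) : f.act 1 0 0 1 = f := by
  ext <;> simp [act]

theorem disc_act (f : BinForm) (p q r s : ℤ) :
    (f.act p q r s).disc = (p * s - q * r) ^ 2 * f.disc := by
  simp only [act, disc]; ring

/-- Proper equivalence, with explicit matrix entries. -/
def Eqv (f g : BinForm) : Prop := ∃ p q r s : ℤ, p * s - q * r = 1 ∧ g = f.act p q r s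

theorem properEquiv_iff (f g : BinForm) : properEquiv f g ↔ Eqv f g := by
  constructor
  · rintro ⟨γ, h⟩
    refine ⟨γ.1 0 0, γ.1 0 1, γ.1 1 0, γ.1 1 1, ?_, h⟩
    rw [← Matrix.det_fin_two]; exact γ.2
  · rintro ⟨p, q, r, s, hd, h⟩
    refine ⟨⟨!![p, q; r, s], by rw [Matrix.det_fin_two]; simpa using hd⟩, ?_⟩
    rw [h]; ext <;> simp [act, subst]

theorem Eqv.symm {f g : BinForm} (h : Eqv f g) : Eqv g f :=
  (properEquiv_iff _ _).1 (properEquiv.symm ((properEquiv_iff _ _).2 h))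

theorem Eqv.trans {f g k : BinForm} (h : Eqv f g) (h' : Eqv g k) : Eqv f k :=
  (properEquiv_iff _ _).1
    (properEquiv.trans ((properEquiv_iff _ _).2 h) ((properEquiv_iff _ _).2 h'))

theorem Eqv.disc_eq {f g : BinForm} (h : Eqv f g) : g.disc = f.disc := by
  obtain ⟨p, q, r, s, hd, rfl⟩ := h
  rw [disc_act, hd]; ring

theorem isPrimitive_of_act {f : BinForm} {p q r s : ℤ} (h : (f.act p q r s).IsPrimitive) :
    f.IsPrimitive := by
  intro d ha hb hc
  refine h d ?_ ?_ ?_ <;> simp only [act]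
  · exact dvd_add (dvd_add (ha.mul_right _) ((hb.mul_right _).mul_right _)) (hc.mul_right _)
  · exact dvd_add (dvd_add (((ha.mul_left _).mul_right _).mul_right _) (hb.mul_right _))
      (((hc.mul_left _).mul_right _).mul_right _)
  · exact dvd_add (dvd_add (ha.mul_right _) ((hb.mul_right _).mul_right _)) (hc.mul_right _)

theorem Eqv.isPrimitive {f g : BinForm} (h : Eqv f g) (hf : f.IsPrimitive) : g.IsPrimitive := by
  obtain ⟨p, q, r, s, -, rfl⟩ := h.symm
  exact isPrimitive_of_act hf

theorem isPosDef_iff (f : BinForm) : f.IsPosDef ↔ 0 < f.a ∧ f.disc < 0 := by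
  constructor
  · intro h
    have ha : 0 < f.a := by simpa [eval] using h 1 0 (by simp)
    refine ⟨ha, ?_⟩
    have h2 := h (-f.b) (2 * f.a) (by simp; omega)
    have h3 : f.eval (-f.b) (2 * f.a) = f.a * (-f.disc) := by simp only [eval, disc]; ring
    rw [h3] at h2
    have := pos_of_mul_pos_right h2 ha.le
    omega
  · rintro ⟨ha, hd⟩ x y hxy
    have h1 : 4 * f.a * f.eval x y = (2 * f.a * x + f.b * y) ^ 2 + (-f.disc) * y ^ 2 := by
      simp only [eval, disc]; ring
    have h2 : 0 < 4 * f.a * f.eval x y := by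
      rw [h1]
      by_cases hy : y = 0
      · subst hy
        have hx : x ≠ 0 := by rintro rfl; simp at hxy
        have : 2 * f.a * x + f.b * 0 ≠ 0 := by
          simp only [mul_zero, add_zero]
          exact mul_ne_zero (by omega) hx
        have := pow_pos (abs_pos.2 this) 2
        rw [sq_abs] at this
        simpa using this
      · have : 0 < -f.disc := by omega
        positivity
    exact pos_of_mul_pos_right h2 (by omega)

theorem Eqv.isPosDef {f g : BinForm} (h : Eqv f g) (hf : f.IsPosDef) : g.IsPosDef := by
  refine (isPosDef_iff g).2 ⟨?_, by rw [h.disc_eq]; exact ((isPosDef_iff f).1 hf).2⟩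
  obtain ⟨p, q, r, s, hd, rfl⟩ := h
  refine hf p r fun h0 => ?_
  simp only [Prod.mk.injEq] at h0
  rw [h0.1, h0.2] at hd
  simp at hd

/-- Every positive definite form is equivalent to a reduced one. -/
theorem exists_eqv_reduced (f : BinForm) (ha : 0 < f.a) (hd : f.disc < 0) :
    ∃ g, Eqv g f ∧ 0 < g.a ∧ |g.b| ≤ g.a ∧ g.a ≤ g.c := by
  induction hn : f.a.toNat using Nat.strong_induction_on generalizing f with
  | _ n ih =>
  -- Translating by this nearest integer to `b / 2a` brings the middle coefficient into `[-a, a]`.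
  -- If then `c < a`, a swap lowers the leading coefficient, and the descent is on that coefficient.
  set t := (f.b + f.a) / (2 * f.a) with ht
  have h1 := Int.emod_nonneg (f.b + f.a) (show 2 * f.a ≠ 0 by omega)
  have h2 := Int.emod_lt_of_pos (f.b + f.a) (show 0 < 2 * f.a by omega)
  have h3 := Int.mul_ediv_add_emod (f.b + f.a) (2 * f.a)
  rw [← ht] at h3
  have hfg : Eqv f (f.act 1 (-t) 0 1) := ⟨1, -t, 0, 1, by ring, rfl⟩
  set g := f.act 1 (-t) 0 1 with hg
  have hga : g.a = f.a := by simp [hg, act]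
  have hgb : g.b = f.b - 2 * f.a * t := by simp [hg, act]; ring
  have hb : |g.b| ≤ g.a := by rw [hga, hgb, abs_le]; constructor <;> linarith
  by_cases hc : g.a ≤ g.c
  · exact ⟨g, hfg.symm, by omega, hb, hc⟩
  · have hk : Eqv g (g.act 0 (-1) 1 0) := ⟨0, -1, 1, 0, by ring, rfl⟩
    have hfk := hfg.trans hk
    set k := g.act 0 (-1) 1 0 with hkd
    have hka : k.a = g.c := by simp [hkd, act]
    have hkp : 0 < k.a := ((isPosDef_iff k).1 (hfk.isPosDef ((isPosDef_iff f).2 ⟨ha, hd⟩))).1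
    obtain ⟨m, hm, hm'⟩ := ih k.a.toNat (by omega) k hkp (by rw [hfk.disc_eq]; exact hd) rfl
    exact ⟨m, hm.trans hfk.symm, hm'⟩

/-- If `|x| ≥ |y|`, the term `ax²` absorbs the cross term. Otherwise `|x| ≤ |y| - 1` by integrality,
and `cy²` absorbs it with at least `c` left over. -/
theorem le_eval_of_ne_zero {g : BinForm} (hb : |g.b| < g.a) (hc : g.a < g.c) {x y : ℤ}
    (hy : y ≠ 0) : g.c ≤ g.eval x y := by
  have h1 : -(|g.b| * |x| * |y|) ≤ g.b * x * y := by
    rw [← abs_mul, ← abs_mul]; exact neg_abs_le _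
  have hy1 : 1 ≤ |y| := Int.one_le_abs hy
  have hx0 := abs_nonneg x
  have hb0 := abs_nonneg g.b
  simp only [eval]
  rw [← sq_abs x, ← sq_abs y]
  generalize |x| = u at *
  generalize |y| = v at *
  generalize |g.b| = β at *
  rcases le_or_gt v u with h | h
  · have : β * u * v ≤ g.a * u ^ 2 := by nlinarith [mul_nonneg hb0 hx0, mul_nonneg hx0 hx0]
    nlinarith [mul_nonneg (show 0 ≤ g.c by omega) (show 0 ≤ v ^ 2 - 1 by nlinarith)]
  · have h4 : β * u * v ≤ β * (v - 1) * v := by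
      have : β * u ≤ β * (v - 1) := mul_le_mul_of_nonneg_left (by omega) hb0
      exact mul_le_mul_of_nonneg_right this (by omega)
    have h5 : 0 ≤ g.a * u ^ 2 := mul_nonneg (by omega) (sq_nonneg _)
    nlinarith [mul_nonneg (show 0 ≤ g.c - β by omega) (show 0 ≤ v ^ 2 - 1 by nlinarith),
      mul_nonneg hb0 (show 0 ≤ v - 1 by omega)]

/-- Equivalent strictly reduced forms are equal, and the matrix is `± 1`. -/
theorem eq_of_act_reduced {g : BinForm} (hb : |g.b| < g.a) (hc : g.a < g.c)
    {p q r s : ℤ} (hd : p * s - q * r = 1)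
    (hb' : |(g.act p q r s).b| < (g.act p q r s).a)
    (hc' : (g.act p q r s).a < (g.act p q r s).c) :
    g.act p q r s = g ∧ q = 0 ∧ r = 0 ∧ p = s := by
  have ha : 0 < g.a := lt_of_le_of_lt (abs_nonneg _) hb
  -- A strictly reduced form has the least leading coefficient in its class. Used in both directions
  -- this equates the two leading coefficients, whereas `r ≠ 0` would give a value at least `c > a`.
  have key : ∀ {f : BinForm}, |f.b| < f.a → f.a < f.c → ∀ {p q r s : ℤ}, p * s - q * r = 1 →
      f.a ≤ (f.act p q r s).a := by
    intro f hb hc p q r s hd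
    have ha : 0 < f.a := lt_of_le_of_lt (abs_nonneg _) hb
    by_cases hr : r = 0
    · subst hr
      have hp : p ≠ 0 := by rintro rfl; simp at hd
      have : 1 ≤ p ^ 2 := by have := sq_pos_of_ne_zero hp; omega
      simp only [act]; nlinarith
    · exact hc.le.trans (le_eval_of_ne_zero hb hc hr)
  have h1 := key hb hc hd
  have hr : r = 0 := by
    by_contra hr
    have h2 : g.c ≤ (g.act p q r s).a := le_eval_of_ne_zero hb hc hr
    have h3 := key hb' hc' (p := s) (q := -q) (r := -r) (s := p) (by linarith)
    rw [act_act] at h3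
    have e : g.act (p * s + q * -r) (p * -q + q * p) (r * s + s * -r) (r * -q + s * p) = g := by
      rw [show p * s + q * -r = 1 by linarith, show p * -q + q * p = 0 by ring,
        show r * s + s * -r = 0 by ring, show r * -q + s * p = 1 by linarith, act_one]
    rw [e] at h3
    omega
  subst hr
  have hps : p * s = 1 := by linarith
  have hpe : p = s ∧ p ^ 2 = 1 := by
    rcases Int.mul_eq_one_iff_eq_one_or_neg_one.1 hps with ⟨rfl, rfl⟩ | ⟨rfl, rfl⟩ <;> simp
  obtain ⟨rfl, hp2⟩ := hpe
  have hq : q = 0 := by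
    have hba : (g.act p q 0 p).a = g.a := by simp [act, hp2]
    have hbb : (g.act p q 0 p).b = g.b + 2 * g.a * (p * q) := by
      simp only [act]; linear_combination g.b * hp2
    rw [hba, hbb, abs_lt] at hb'
    rw [abs_lt] at hb
    -- The two middle coefficients lie strictly between `-a` and `a` and differ by `2a · pq`.
    have hpq : p * q = 0 := by
      by_contra h0
      rcases lt_or_gt_of_ne h0 with h | h
      · nlinarith
      · nlinarith
    have hp : p ≠ 0 := by rintro rfl; simp at hp2
    exact (mul_eq_zero.1 hpq).resolve_left hp
  subst hq
  refine ⟨?_, rfl, rfl, rfl⟩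
  ext <;> simp [act, hp2]
  linear_combination g.b * hp2

/-- Primitive reduced forms of discriminant `D`. -/
def reducedForms (D : ℤ) : Set BinForm :=
  {f | f.disc = D ∧ f.IsPrimitive ∧ 0 < f.a ∧ |f.b| ≤ f.a ∧ f.a ≤ f.c}

/-- Primitive strictly reduced forms of discriminant `D`. -/
def strictlyReducedForms (D : ℤ) : Set BinForm :=
  {f | f.disc = D ∧ f.IsPrimitive ∧ |f.b| < f.a ∧ f.a < f.c}

theorem strictlyReducedForms_subset (D : ℤ) : strictlyReducedForms D ⊆ reducedForms D := by
  rintro f ⟨h1, h2, h3, h4⟩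
  exact ⟨h1, h2, lt_of_le_of_lt (abs_nonneg _) h3, h3.le, h4.le⟩

theorem finite_of_bounded {S : Set BinForm} (M : ℤ)
    (h : ∀ f ∈ S, |f.a| ≤ M ∧ |f.b| ≤ M ∧ |f.c| ≤ M) : S.Finite := by
  refine Set.Finite.of_finite_image (f := fun f : BinForm => (f.a, f.b, f.c)) (Set.Finite.subset
    ((Set.finite_Icc (-M) M).prod ((Set.finite_Icc (-M) M).prod (Set.finite_Icc (-M) M))) ?_) ?_
  · rintro _ ⟨f, hf, rfl⟩
    obtain ⟨h1, h2, h3⟩ := h f hf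
    exact ⟨abs_le.1 h1, abs_le.1 h2, abs_le.1 h3⟩
  · intro f _ g _ hfg
    simp only [Prod.mk.injEq] at hfg
    exact BinForm.ext hfg.1 hfg.2.1 hfg.2.2

theorem reducedForms_finite (D : ℤ) : (reducedForms D).Finite := by
  refine finite_of_bounded |D| ?_
  rintro f ⟨h1, -, ha, hb, hc⟩
  have hb2 : f.b ^ 2 ≤ f.a ^ 2 := sq_le_sq.2 (by rwa [abs_of_pos ha])
  have h2 : f.c ≤ -D := by
    rw [← h1, disc]; nlinarith
  have h3 := neg_abs_le D
  rw [abs_of_pos ha, abs_of_pos (by omega : 0 < f.c)]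
  omega

end BinForm

/-! ### Class numbers bounded by families of forms -/

open BinForm

/-- Upper bounds come from a family meeting every class, lower bounds from a pairwise inequivalent
family (`card_le_gaussClassNumber`). -/
theorem card_quotient_le {α : Type} [Finite α] {D : ℤ} (F : α → BinForm)
    (hF : ∀ f : PrimPosForm D, ∃ i, Eqv (F i) f.1) :
    Finite (Quotient (primPosSetoid D)) ∧ gaussClassNumber D ≤ Nat.card α := by
  choose i hi using fun q : Quotient (primPosSetoid D) => hF q.out
  have hinj : Function.Injective i := by
    intro q q' h
    have h1 := hi q
    rw [h] at h1
    have h2 : Eqv q.out.1 q'.out.1 := h1.symm.trans (hi q')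
    rw [← Quotient.out_eq q, ← Quotient.out_eq q']
    exact Quotient.sound ((properEquiv_iff _ _).2 h2)
  exact ⟨Finite.of_injective i hinj, Nat.card_le_card_of_injective i hinj⟩

theorem exists_reduced_eqv {D : ℤ} {f : BinForm} (h1 : f.disc = D) (h2 : f.IsPrimitive)
    (h3 : f.IsPosDef) : ∃ g ∈ reducedForms D, Eqv g f := by
  obtain ⟨ha, hd⟩ := (isPosDef_iff f).1 h3
  obtain ⟨g, hg, hga, hgb, hgc⟩ := exists_eqv_reduced f ha hd
  exact ⟨g, ⟨by rw [hg.symm.disc_eq, h1], hg.symm.isPrimitive h2, hga, hgb, hgc⟩, hg⟩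

theorem finite_quotient_and_card_le (D : ℤ) :
    Finite (Quotient (primPosSetoid D)) ∧ gaussClassNumber D ≤ (reducedForms D).ncard := by
  have := (reducedForms_finite D).to_subtype
  refine card_quotient_le (fun g : reducedForms D => g.1) fun f => ?_
  obtain ⟨g, hg, h⟩ := exists_reduced_eqv f.2.1 f.2.2.1 f.2.2.2
  exact ⟨⟨g, hg⟩, h⟩

theorem card_le_gaussClassNumber {α : Type} {D : ℤ} (F : α → BinForm)
    (h1 : ∀ i, (F i).disc = D ∧ (F i).IsPrimitive ∧ (F i).IsPosDef)
    (h2 : ∀ i j, Eqv (F i) (F j) → i = j) : Nat.card α ≤ gaussClassNumber D := by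
  -- Finiteness matters: `Nat.card` of an infinite quotient would be `0`.
  have := (finite_quotient_and_card_le D).1
  refine Nat.card_le_card_of_injective
    (fun i => (⟦⟨F i, h1 i⟩⟧ : Quotient (primPosSetoid D))) fun i j h => ?_
  exact h2 i j ((properEquiv_iff _ _).1 (Quotient.exact (s := primPosSetoid D) h))

/-! ### From discriminant `D` to discriminant `P²D` -/

namespace BinForm

/-- A `P`-primitive form whose discriminant is divisible by `P²` comes from a form of smaller
discriminant by the substitution `x ↦ P x`. -/
theorem exists_act_eq {P : ℕ} (hP : P.Prime) (hP2 : P ≠ 2) {D : ℤ} {f : BinForm}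
    (hf : f.disc = P ^ 2 * D) (hprim : f.IsPrimitive) :
    ∃ f' g : BinForm, Eqv f f' ∧ f' = g.act P 0 0 1 := by
  have hPi : Prime (P : ℤ) := Nat.prime_iff_prime_int.1 hP
  have hnu : ¬ IsUnit (P : ℤ) := hPi.not_isUnit
  have h2 : ¬ (P : ℤ) ∣ 2 := fun h => hP2 ((Nat.prime_dvd_prime_iff_eq hP Nat.prime_two).1
    (by exact_mod_cast h))
  have h4 : IsCoprime (4 : ℤ) P := by
    have : IsCoprime (2 : ℤ) P := ((Prime.coprime_iff_not_dvd hPi).2 h2).symm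
    exact (show (4 : ℤ) = 2 * 2 by norm_num) ▸ this.mul_left this
  have hP0 : (P : ℤ) ≠ 0 := hPi.ne_zero
  -- Modulo `P` the form is a constant times the square of a linear form. Once that linear form is
  -- `y`, so that `P ∣ b` and `P ∤ c`, the divisibility `P² ∣ 4ac` forces `P² ∣ a`.
  have main : ∀ k : BinForm, Eqv f k → (P : ℤ) ∣ k.b → ¬ (P : ℤ) ∣ k.c →
      ∃ f' g : BinForm, Eqv f f' ∧ f' = g.act P 0 0 1 := by
    intro k hk hb hc
    have hkd : k.b ^ 2 - 4 * k.a * k.c = P ^ 2 * D := by rw [← hf, ← hk.disc_eq, disc]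
    obtain ⟨b, hb⟩ := hb
    have hdiv : (P : ℤ) ^ 2 ∣ k.a * (4 * k.c) := ⟨b ^ 2 - D, by rw [hb] at hkd; linear_combination -hkd⟩
    have hco : IsCoprime ((P : ℤ) ^ 2) (4 * k.c) :=
      (IsCoprime.mul_left h4 ((Prime.coprime_iff_not_dvd hPi).2 hc).symm).symm.pow_left
    obtain ⟨a, ha⟩ := hco.dvd_of_dvd_mul_right hdiv
    refine ⟨k, ⟨a, b, k.c⟩, hk, ?_⟩
    ext <;> simp [act, ha, hb] <;> ring
  have hfd : f.b ^ 2 - 4 * f.a * f.c = P ^ 2 * D := hf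
  by_cases ha : (P : ℤ) ∣ f.a
  · have hb : (P : ℤ) ∣ f.b := by
      refine hPi.dvd_of_dvd_pow (n := 2) ?_
      obtain ⟨a, ha⟩ := ha
      exact ⟨P * D + 4 * a * f.c, by rw [ha] at hfd; linear_combination hfd⟩
    exact main f ⟨1, 0, 0, 1, by ring, (act_one f).symm⟩ hb fun hc => hnu (hprim P ha hb hc)
  · have hco : IsCoprime (P : ℤ) (2 * f.a) :=
      (IsCoprime.mul_left ((Prime.coprime_iff_not_dvd hPi).2 h2).symm
        ((Prime.coprime_iff_not_dvd hPi).2 ha).symm).symm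
    obtain ⟨u, v, huv⟩ := hco
    -- Here `v` inverts `2a` modulo `P`: the translation by `-vb` kills the middle coefficient
    -- modulo `P`, and the swap puts `a` in last place.
    refine main (f.act (-(v * f.b)) (-1) 1 0) ?_ ?_ ?_
    · exact ⟨_, _, _, _, by ring, rfl⟩
    · exact ⟨-f.b * u, by simp only [act]; linear_combination f.b * huv⟩
    · simpa [act] using ha

/-- The form `g(P x + k y, y)` for `k < P`, and `g(x, P y)` otherwise. -/
def hecke (P : ℕ) (k : ℕ) (g : BinForm) : BinForm :=
  if k < P then g.act P k 0 1 else g.act 1 0 0 P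

/-- The `P + 1` matrices behind `hecke` represent the integral matrices of determinant `P` modulo
`SL₂(ℤ)` on the right. Thus an `SL₂(ℤ)` substitution made before `diag(P, 1)` can be moved behind
one of them. -/
theorem exists_hecke_eqv {P : ℕ} (hP : P.Prime) (g : BinForm) {p q r s : ℤ}
    (hd : p * s - q * r = 1) :
    ∃ k < P + 1, Eqv (hecke P k g) ((g.act p q r s).act P 0 0 1) := by
  have hPi : Prime (P : ℤ) := Nat.prime_iff_prime_int.1 hP
  have hP0 : (0 : ℤ) < P := by exact_mod_cast hP.pos
  rw [act_act]
  by_cases hs : (P : ℤ) ∣ s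
  · obtain ⟨t, rfl⟩ := hs
    refine ⟨P, by omega, ?_⟩
    rw [hecke, if_neg (lt_irrefl _)]
    refine ⟨p * P, q, r, t, by linear_combination hd, ?_⟩
    rw [act_act]
    ring_nf
  · obtain ⟨u, v, huv⟩ := (Prime.coprime_iff_not_dvd hPi).2 hs
    have h1 := Int.emod_nonneg (q * v) hP0.ne'
    have h2 := Int.emod_lt_of_pos (q * v) hP0
    have h3 := Int.mul_ediv_add_emod (q * v) P
    -- Since `v` inverts `s` modulo `P`, the label of the coset is `q / s` modulo `P`.
    set k := (q * v) % P
    set w := (q * v) / P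
    have hk : ((k.toNat : ℕ) : ℤ) = k := Int.toNat_of_nonneg h1
    refine ⟨k.toNat, by omega, ?_⟩
    rw [hecke, if_pos (by omega), hk]
    refine ⟨p - k * r, q * u + w * s, r * P, s, ?_, ?_⟩
    · linear_combination hd - r * s * h3 - q * r * huv
    · rw [act_act]
      have e1 : (P : ℤ) * (p - k * r) + k * (r * P) = p * P + q * 0 := by ring
      have e2 : (P : ℤ) * (q * u + w * s) + k * s = p * 0 + q * 1 := by
        linear_combination q * huv + s * h3
      rw [e1, e2]
      ring_nf

end BinForm

/-- Each class descends to discriminant `D`, is reduced there, and returns through one of the `P +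
1` substitutions. -/
theorem gaussClassNumber_level_le {P : ℕ} (hP : P.Prime) (hP2 : P ≠ 2) {D : ℤ} (hD : D < 0) :
    gaussClassNumber (P ^ 2 * D) ≤ (P + 1) * (reducedForms D).ncard := by
  have := (reducedForms_finite D).to_subtype
  have hcard : Nat.card (Fin (P + 1) × reducedForms D) = (P + 1) * (reducedForms D).ncard := by
    rw [Nat.card_prod, Nat.card_eq_fintype_card, Fintype.card_fin]; rfl
  rw [← hcard]
  refine (card_quotient_le (fun i : Fin (P + 1) × reducedForms D => hecke P i.1 i.2.1)
    fun f => ?_).2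
  obtain ⟨f', g, hff', hg⟩ := exists_act_eq hP hP2 f.2.1 f.2.2.1
  have hP0 : (0 : ℤ) < P := by exact_mod_cast hP.pos
  have hprim : g.IsPrimitive := by
    refine isPrimitive_of_act (p := P) (q := 0) (r := 0) (s := 1) ?_
    rw [← hg]; exact hff'.isPrimitive f.2.2.1
  have hdisc : g.disc = D := by
    have h1 := hff'.disc_eq
    rw [hg, disc_act, f.2.1] at h1
    have : (P : ℤ) ^ 2 ≠ 0 := by positivity
    refine mul_left_cancel₀ this ?_
    linear_combination h1
  have hpos : g.IsPosDef := by
    refine (isPosDef_iff g).2 ⟨?_, by rwa [hdisc]⟩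
    have h1 := ((isPosDef_iff f').1 (hff'.isPosDef f.2.2.2)).1
    rw [hg] at h1
    simp only [act, mul_zero, add_zero, ne_eq, OfNat.ofNat_ne_zero, not_false_eq_true,
      zero_pow] at h1
    exact pos_of_mul_pos_left h1 (by positivity)
  obtain ⟨g', hg', p, q, r, s, hd, rfl⟩ := exists_reduced_eqv hdisc hprim hpos
  obtain ⟨k, hk, hkE⟩ := exists_hecke_eqv hP g' hd
  refine ⟨(⟨k, hk⟩, ⟨g', hg'⟩), ?_⟩
  exact hkE.trans (by rw [← hg]; exact hff'.symm)

namespace BinForm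

/-- The last coefficient is `g(k, 1)`, so a common divisor is prime to `P`; the powers of `P` can
then be cancelled. -/
theorem hecke_isPrimitive {P : ℕ} (hP : P.Prime) {g : BinForm} (hg : g.IsPrimitive) {k : ℤ}
    (hk : ¬ (P : ℤ) ∣ g.eval k 1) : (g.act P k 0 1).IsPrimitive := by
  have hPi : Prime (P : ℤ) := Nat.prime_iff_prime_int.1 hP
  intro d ha hb hc
  simp only [act, eval] at ha hb hc hk
  have hco : IsCoprime d (P : ℤ) := by
    refine ((Prime.coprime_iff_not_dvd hPi).2 fun h => hk ?_).symm
    have := h.trans hc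
    simpa using this
  have ha' : d ∣ g.a := by
    refine (hco.pow_right (n := 2)).dvd_of_dvd_mul_right ?_
    simpa using ha
  have hb' : d ∣ g.b := by
    have h1 : d ∣ 2 * g.a * k + g.b := by
      refine hco.dvd_of_dvd_mul_right (?_ : d ∣ _ * (P : ℤ))
      convert hb using 1; ring
    exact (dvd_add_right ((ha'.mul_left _).mul_right _)).1 h1
  refine hg d ha' hb' ?_
  have : d ∣ (g.a * k ^ 2 + g.b * k * 1) + g.c := by simpa using hc
  exact (dvd_add_right (dvd_add (ha'.mul_right _) ((hb'.mul_right _).mul_right _))).1 this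

theorem act_left_cancel {P : ℤ} (hP : P ≠ 0) {g g' : BinForm} {k : ℤ}
    (h : g.act P k 0 1 = g'.act P k 0 1) : g = g' := by
  simp only [act, BinForm.mk.injEq] at h
  obtain ⟨h1, h2, h3⟩ := h
  have ha : g.a = g'.a := mul_right_cancel₀ (pow_ne_zero 2 hP) (by linear_combination h1)
  have hb : g.b = g'.b := mul_right_cancel₀ hP (by rw [ha] at h2; linear_combination h2)
  rw [ha, hb] at h3
  exact BinForm.ext ha hb (by linear_combination h3)

/-- Modulo `P` the first form is `g(k, 1) y²`, so comparing leading coefficients gives `P ∣ r`. The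
linking matrix then conjugates to an integral one between `g` and `g'`, and strict reducedness makes
that one `±1`. -/
theorem hecke_injective {P : ℕ} (hP : P.Prime) {g g' : BinForm} {k k' : ℤ}
    (hb : |g.b| < g.a) (hc : g.a < g.c) (hb' : |g'.b| < g'.a) (hc' : g'.a < g'.c)
    (hk : ¬ (P : ℤ) ∣ g.eval k 1) (h : Eqv (g.act P k 0 1) (g'.act P k' 0 1)) :
    g = g' ∧ (P : ℤ) ∣ k' - k := by
  have hPi : Prime (P : ℤ) := Nat.prime_iff_prime_int.1 hP
  obtain ⟨p, q, r, s, hd, h⟩ := h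
  have hr : (P : ℤ) ∣ r := by
    have h1 := congrArg BinForm.a h
    simp only [act] at h1
    refine hPi.dvd_of_dvd_pow (n := 2) ((hPi.dvd_or_dvd (?_ : (P : ℤ) ∣ g.eval k 1 * r ^ 2)).resolve_left hk)
    refine ⟨P * g'.a - g.a * P * p ^ 2 - (2 * g.a * k + g.b) * p * r, ?_⟩
    simp only [eval]
    linear_combination -h1
  obtain ⟨t, rfl⟩ := hr
  have key : (g.act (p + k * t) (-k' * (p + k * t) + (P * q + k * s)) t (s - k' * t)) = g' := by
    refine act_left_cancel (P := P) (k := k') hPi.ne_zero ?_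
    rw [h, act_act, act_act]
    ring_nf
  obtain ⟨h1, h2, h3, h4⟩ := eq_of_act_reduced hb hc
    (p := p + k * t) (q := -k' * (p + k * t) + (P * q + k * s)) (r := t) (s := s - k' * t)
    (by linear_combination hd) (by rw [key]; exact hb') (by rw [key]; exact hc')
  refine ⟨by rw [← key, h1], ?_⟩
  subst h3
  simp only [mul_zero, add_zero, sub_zero] at h2 h4 hd
  subst h4
  exact ⟨q * p, by linear_combination -p * h2 - (k' - k) * hd⟩

/-- A nonzero polynomial of degree at most two has at most two roots modulo `P`, and `P ∤ disc`
excludes `a ≡ b ≡ 0`. -/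
theorem card_not_root_ge {P : ℕ} [Fact P.Prime] {g : BinForm}
    (hD : ¬ (P : ℤ) ∣ g.disc) :
    P - 2 ≤ Nat.card {k : ZMod P // ¬ (P : ℤ) ∣ g.eval (k.val : ℤ) 1} := by
  classical
  set p : Polynomial (ZMod P) := .C (g.a : ZMod P) * .X ^ 2 + .C (g.b : ZMod P) * .X
    + .C (g.c : ZMod P) with hp
  have hp0 : p ≠ 0 := by
    intro h0
    apply hD
    have h1 : p.coeff 2 = g.a := by simp [hp, -map_intCast, -eq_intCast]
    have h2 : p.coeff 1 = g.b := by simp [hp, -map_intCast, -eq_intCast]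
    rw [h0, Polynomial.coeff_zero] at h1 h2
    rw [← ZMod.intCast_zmod_eq_zero_iff_dvd, disc]
    push_cast
    rw [← h1, ← h2]; ring
  have h1 : Fintype.card {k : ZMod P // (P : ℤ) ∣ g.eval (k.val : ℤ) 1} ≤ 2 := by
    rw [Fintype.card_subtype]
    refine (Finset.card_le_card (t := p.roots.toFinset) fun k hk => ?_).trans
      ((Multiset.toFinset_card_le _).trans ((Polynomial.card_roots' p).trans
        Polynomial.natDegree_quadratic_le))
    rw [Finset.mem_filter, ← ZMod.intCast_zmod_eq_zero_iff_dvd] at hk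
    rw [Multiset.mem_toFinset, Polynomial.mem_roots hp0, Polynomial.IsRoot, hp]
    simpa [eval] using hk.2
  rw [Nat.card_eq_fintype_card, Fintype.card_subtype_compl, ZMod.card]
  omega

end BinForm

theorem le_gaussClassNumber_level {P : ℕ} (hP : P.Prime) {D : ℤ}
    (hD : D < 0) (hPD : ¬ (P : ℤ) ∣ D) :
    (P - 2) * (strictlyReducedForms D).ncard ≤ gaussClassNumber (P ^ 2 * D) := by
  have : Fact P.Prime := ⟨hP⟩
  have hPi : Prime (P : ℤ) := Nat.prime_iff_prime_int.1 hP
  have hfin := ((reducedForms_finite D).subset (strictlyReducedForms_subset D)).to_subtype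
  have := Fintype.ofFinite (strictlyReducedForms D)
  have h1 := card_le_gaussClassNumber (D := P ^ 2 * D)
    (fun i : Σ g : strictlyReducedForms D, {k : ZMod P // ¬ (P : ℤ) ∣ g.1.eval (k.val : ℤ) 1} =>
      i.1.1.act P (i.2.1.val : ℤ) 0 1) ?_ ?_
  · refine le_trans ?_ h1
    rw [Nat.card_sigma]
    calc (P - 2) * (strictlyReducedForms D).ncard
        = ∑ g : strictlyReducedForms D, (P - 2) := by
          rw [Finset.sum_const, Finset.card_univ, smul_eq_mul, mul_comm,
            ← Nat.card_coe_set_eq, Nat.card_eq_fintype_card]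
      _ ≤ _ := Finset.sum_le_sum fun g _ => card_not_root_ge (by rw [g.2.1]; exact hPD)
  · rintro ⟨⟨g, hg⟩, ⟨k, hk⟩⟩
    have hP2 : (0 : ℤ) < P ^ 2 := pow_pos (by exact_mod_cast hP.pos) 2
    have hd : (g.act P (k.val : ℤ) 0 1).disc = P ^ 2 * D := by rw [disc_act, hg.1]; ring
    refine ⟨hd, hecke_isPrimitive hP hg.2.1 hk, (isPosDef_iff _).2 ⟨?_, ?_⟩⟩
    · have ha : 0 < g.a := lt_of_le_of_lt (abs_nonneg _) hg.2.2.1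
      have := mul_pos ha hP2
      simpa [act] using this
    · rw [hd]; exact mul_neg_of_pos_of_neg hP2 hD
  · rintro ⟨⟨g, hg⟩, ⟨k, hk⟩⟩ ⟨⟨g', hg'⟩, ⟨k', hk'⟩⟩ h
    obtain ⟨rfl, hkk⟩ := hecke_injective hP hg.2.2.1 hg.2.2.2 hg'.2.2.1 hg'.2.2.2 hk h
    have : k = k' := by
      rw [← ZMod.intCast_zmod_eq_zero_iff_dvd] at hkk
      push_cast [ZMod.natCast_zmod_val] at hkk
      exact (sub_eq_zero.1 hkk).symm
    subst this
    rfl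

/-! ### Forms with even middle coefficient and determinant `N` -/

namespace BinForm

/-- The forms `a x² + 2 b x y + c y²` with `a c - b² = N`, reduced. -/
def reducedEven (N : ℤ) : Set BinForm :=
  {f | f.a * f.c - f.b ^ 2 = N ∧ 0 < f.a ∧ 2 * |f.b| ≤ f.a ∧ f.a ≤ f.c}

/-- The forms `a x² + 2 b x y + c y²` with `a c - b² = N`, strictly reduced. -/
def strictlyReducedEven (N : ℤ) : Set BinForm :=
  {f | f.a * f.c - f.b ^ 2 = N ∧ 2 * |f.b| < f.a ∧ f.a < f.c}

theorem reducedEven_finite (N : ℤ) : (reducedEven N).Finite := by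
  refine finite_of_bounded (2 * |N|) ?_
  rintro f ⟨h1, ha, hb, hc⟩
  have h0 := abs_nonneg f.b
  have hb2 : 4 * |f.b| ^ 2 ≤ f.a ^ 2 := by nlinarith
  rw [sq_abs] at hb2
  have h2 : f.c ≤ 2 * N := by nlinarith
  have h3 := le_abs_self N
  rw [abs_of_pos ha, abs_of_pos (by omega : 0 < f.c)]
  omega

/-- `a x² + b x y + c y² ↦ a x² + 2 b x y + c y²`. -/
def doubleB (f : BinForm) : BinForm := ⟨f.a, 2 * f.b, f.c⟩

/-- `a x² + b x y + c y² ↦ 2 a x² + b x y + 2 c y²`. -/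
def doubleAC (f : BinForm) : BinForm := ⟨2 * f.a, f.b, 2 * f.c⟩

theorem doubleB_injective : Function.Injective doubleB := by
  intro f g h
  simp only [doubleB, BinForm.mk.injEq] at h
  ext <;> omega

theorem doubleAC_injective : Function.Injective doubleAC := by
  intro f g h
  simp only [doubleAC, BinForm.mk.injEq] at h
  ext <;> omega

/-- Forms of discriminant `-4N` and doubled forms of discriminant `-N` both have determinant `N`.
They never coincide, because `2` divides all coefficients of the latter but not of a primitive form.
-/
theorem card_reducedForms_add_le (N : ℕ) :
    (reducedForms (-(4 * (N : ℤ)))).ncard + (reducedForms (-(N : ℤ))).ncard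
      ≤ (reducedEven N).ncard := by
  set S : Set BinForm := doubleB ⁻¹' reducedForms (-(4 * (N : ℤ)))
  set T : Set BinForm := doubleAC '' reducedForms (-(N : ℤ))
  have hS : S.ncard = (reducedForms (-(4 * (N : ℤ)))).ncard := by
    rw [← Set.ncard_image_of_injective S doubleB_injective]
    congr 1
    refine Set.image_preimage_eq_of_subset fun f hf => ?_
    have h1 : f.b ^ 2 - 4 * f.a * f.c = -(4 * (N : ℤ)) := hf.1
    have h2 : (2 : ℤ) ∣ f.b := Int.prime_two.dvd_of_dvd_pow (n := 2)
      ⟨2 * f.a * f.c - 2 * N, by linear_combination h1⟩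
    obtain ⟨b, hb⟩ := h2
    exact ⟨⟨f.a, b, f.c⟩, by ext <;> simp [doubleB, hb]⟩
  have hT : T.ncard = (reducedForms (-(N : ℤ))).ncard :=
    Set.ncard_image_of_injective _ doubleAC_injective
  have hSsub : S ⊆ reducedEven N := by
    rintro f ⟨h1, -, h2, h3, h4⟩
    simp only [doubleB, disc, abs_mul] at h1 h2 h3 h4
    exact ⟨by linarith, h2, by simpa using h3, h4⟩
  have hTsub : T ⊆ reducedEven N := by
    rintro _ ⟨f, ⟨h1, -, h2, h3, h4⟩, rfl⟩
    simp only [disc] at h1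
    refine ⟨?_, ?_, ?_, ?_⟩ <;> simp only [doubleAC] <;> linarith
  have hdisj : Disjoint S T := by
    rw [Set.disjoint_left]
    rintro _ hfS ⟨f, -, rfl⟩
    have := hfS.2.1 2 (by simp [doubleB, doubleAC]) (by simp [doubleB]) (by simp [doubleB, doubleAC])
    exact Int.prime_two.not_isUnit this
  have hfin := reducedEven_finite N
  rw [← hS, ← hT, ← Set.ncard_union_eq hdisj (hfin.subset hSsub) (hfin.subset hTsub)]
  exact Set.ncard_le_ncard (Set.union_subset hSsub hTsub) hfin

theorem isUnit_of_sq_dvd {N : ℕ} (hN : Squarefree N) {d : ℤ} (h : d ^ 2 ∣ (N : ℤ)) : IsUnit d :=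
  (Int.squarefree_natCast.2 hN) d (by rwa [← sq])

/-- The parity of `a` and `c` decides between the two sources. Primitivity is automatic, since the
square of an offending common divisor would divide the square-free `N`. -/
theorem card_strictlyReducedEven_le {N : ℕ} (hN : Squarefree N) :
    (strictlyReducedEven N).ncard ≤ (strictlyReducedForms (-(4 * (N : ℤ)))).ncard
      + (strictlyReducedForms (-(N : ℤ))).ncard := by
  have hfin : ∀ D, (strictlyReducedForms D).Finite := fun D =>
    (reducedForms_finite D).subset (strictlyReducedForms_subset D)
  have hsub : strictlyReducedEven N ⊆ doubleB ⁻¹' strictlyReducedForms (-(4 * (N : ℤ)))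
      ∪ doubleAC '' strictlyReducedForms (-(N : ℤ)) := by
    rintro f ⟨h1, h2, h3⟩
    by_cases he : (2 : ℤ) ∣ f.a ∧ (2 : ℤ) ∣ f.c
    · right
      obtain ⟨⟨a, ha⟩, ⟨c, hc⟩⟩ := he
      rw [ha, hc] at h1
      refine ⟨⟨a, f.b, c⟩, ⟨?_, ?_, ?_, ?_⟩, by ext <;> simp [doubleAC, ha, hc]⟩
      · simp only [disc]; linear_combination -h1
      · rintro d ⟨x, hx⟩ ⟨y, hy⟩ ⟨z, hz⟩
        simp only at hx hy hz
        refine isUnit_of_sq_dvd hN ⟨4 * x * z - y ^ 2, ?_⟩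
        rw [← h1, hx, hy, hz]; ring
      · simp only; omega
      · simp only; omega
    · left
      refine ⟨?_, ?_, ?_, h3⟩
      · simp only [disc, doubleB]; linear_combination -4 * h1
      · intro d ha hb hc
        simp only [doubleB] at ha hb hc
        have h2d : ¬ (2 : ℤ) ∣ d := fun h => he ⟨h.trans ha, h.trans hc⟩
        have hco : IsCoprime d 2 := ((Prime.coprime_iff_not_dvd Int.prime_two).2 h2d).symm
        obtain ⟨y, hy⟩ := hco.dvd_of_dvd_mul_left hb
        obtain ⟨x, hx⟩ := ha
        obtain ⟨z, hz⟩ := hc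
        refine isUnit_of_sq_dvd hN ⟨x * z - y ^ 2, ?_⟩
        rw [← h1, hx, hy, hz]; ring
      · simp only [doubleB, abs_mul]; simpa using h2
  have hpre : (doubleB ⁻¹' strictlyReducedForms (-(4 * (N : ℤ)))).Finite :=
    (hfin _).preimage doubleB_injective.injOn
  refine (Set.ncard_le_ncard hsub (hpre.union ((hfin _).image _))).trans
    ((Set.ncard_union_le _ _).trans (add_le_add ?_ (Set.ncard_image_le (hfin _))))
  rw [← Set.ncard_image_of_injective _ doubleB_injective]
  exact Set.ncard_le_ncard (Set.image_preimage_subset _ _) (hfin _)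

end BinForm

/-! ### Bounds for a single level -/

/-- The contribution of `N` to the class number average. -/
noncomputable def levelSum (P N : ℕ) : ℝ :=
  (gaussClassNumber (-((P : ℤ) ^ 2 * N)) : ℝ) / 2 + (gaussClassNumber (-(N : ℤ)) : ℝ) / 2
        + (gaussClassNumber (-(4 * (P : ℤ) ^ 2 * N)) : ℝ) / 2
        + (gaussClassNumber (-(4 * (N : ℤ))) : ℝ) / 2

/-- The factor `P + 2` is `P + 1` from level `P²` plus `1` from the discriminants prime to `P` or
not, `-N` and `-4N`, themselves. -/
theorem levelSum_le {P N : ℕ} (hP : P.Prime) (hP2 : P ≠ 2) (hN : 0 < N) :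
    levelSum P N ≤ (P + 2) / 2 * (reducedEven N).ncard := by
  have e1 : -((P : ℤ) ^ 2 * N) = (P : ℤ) ^ 2 * (-(N : ℤ)) := by ring
  have e2 : -(4 * (P : ℤ) ^ 2 * N) = (P : ℤ) ^ 2 * (-(4 * (N : ℤ))) := by ring
  have h1 := gaussClassNumber_level_le hP hP2 (D := -(N : ℤ)) (by omega)
  have h2 := gaussClassNumber_level_le hP hP2 (D := -(4 * (N : ℤ))) (by omega)
  have h3 := (finite_quotient_and_card_le (-(N : ℤ))).2
  have h4 := (finite_quotient_and_card_le (-(4 * (N : ℤ)))).2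
  have h5 := card_reducedForms_add_le N
  rw [levelSum, e1, e2]
  have h1' : (gaussClassNumber ((P : ℤ) ^ 2 * (-(N : ℤ))) : ℝ)
    ≤ (P + 1) * ((reducedForms (-(N : ℤ))).ncard : ℝ) := by exact_mod_cast h1
  have h2' : (gaussClassNumber ((P : ℤ) ^ 2 * (-(4 * (N : ℤ)))) : ℝ)
    ≤ (P + 1) * ((reducedForms (-(4 * (N : ℤ)))).ncard : ℝ) := by exact_mod_cast h2
  have h3' : (gaussClassNumber (-(N : ℤ)) : ℝ) ≤ ((reducedForms (-(N : ℤ))).ncard : ℝ) := by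
    exact_mod_cast h3
  have h4' : (gaussClassNumber (-(4 * (N : ℤ))) : ℝ)
    ≤ ((reducedForms (-(4 * (N : ℤ)))).ncard : ℝ) := by exact_mod_cast h4
  have h5' : ((reducedForms (-(4 * (N : ℤ)))).ncard : ℝ) + ((reducedForms (-(N : ℤ))).ncard : ℝ)
      ≤ ((reducedEven N).ncard : ℝ) := by exact_mod_cast h5
  have h6 := mul_le_mul_of_nonneg_left h5' (show (0 : ℝ) ≤ (P + 2) / 2 by positivity)
  linarith

theorem le_levelSum {P N : ℕ} (hP : P.Prime) (hP2 : P ≠ 2) (hN : Squarefree N) (hPN : ¬ P ∣ N) :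
    ((P : ℝ) - 2) / 2 * (strictlyReducedEven N).ncard ≤ levelSum P N := by
  have hPi : Prime (P : ℤ) := Nat.prime_iff_prime_int.1 hP
  have hN0 : 0 < N := hN.ne_zero.bot_lt
  have hPN' : ¬ (P : ℤ) ∣ (N : ℤ) := by rwa [Int.natCast_dvd_natCast]
  have hP2' : ¬ (P : ℤ) ∣ 2 := fun h => hP2 ((Nat.prime_dvd_prime_iff_eq hP Nat.prime_two).1
    (by exact_mod_cast h))
  have e1 : -((P : ℤ) ^ 2 * N) = (P : ℤ) ^ 2 * (-(N : ℤ)) := by ring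
  have e2 : -(4 * (P : ℤ) ^ 2 * N) = (P : ℤ) ^ 2 * (-(4 * (N : ℤ))) := by ring
  have h1 := le_gaussClassNumber_level hP (D := -(N : ℤ)) (by omega) (by rwa [dvd_neg])
  have h2 := le_gaussClassNumber_level hP (D := -(4 * (N : ℤ))) (by omega) (by
    rw [dvd_neg, show (4 : ℤ) * N = 2 * (2 * N) by ring]
    intro h
    exact hPN' (((hPi.dvd_or_dvd ((hPi.dvd_or_dvd h).resolve_left hP2')).resolve_left hP2')))
  have h5 := card_strictlyReducedEven_le hN
  have hle := hP.two_le
  rw [levelSum, e1, e2]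
  have h1' : ((P : ℝ) - 2) * ((strictlyReducedForms (-(N : ℤ))).ncard : ℝ)
      ≤ (gaussClassNumber ((P : ℤ) ^ 2 * (-(N : ℤ))) : ℝ) := by
    have := (Nat.cast_le (α := ℝ)).2 h1
    push_cast [Nat.cast_sub hle] at this
    exact this
  have h2' : ((P : ℝ) - 2) * ((strictlyReducedForms (-(4 * (N : ℤ)))).ncard : ℝ)
      ≤ (gaussClassNumber ((P : ℤ) ^ 2 * (-(4 * (N : ℤ)))) : ℝ) := by
    have := (Nat.cast_le (α := ℝ)).2 h2
    push_cast [Nat.cast_sub hle] at this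
    exact this
  have h5' : ((strictlyReducedEven N).ncard : ℝ)
      ≤ ((strictlyReducedForms (-(4 * (N : ℤ)))).ncard : ℝ)
        + ((strictlyReducedForms (-(N : ℤ))).ncard : ℝ) := by exact_mod_cast h5
  have hP3 : (2 : ℝ) ≤ P := by exact_mod_cast hle
  have h6 := mul_le_mul_of_nonneg_left h5' (show (0 : ℝ) ≤ (P - 2) / 2 by linarith)
  have h7 : (0 : ℝ) ≤ gaussClassNumber (-(N : ℤ)) := Nat.cast_nonneg _
  have h8 : (0 : ℝ) ≤ gaussClassNumber (-(4 * (N : ℤ))) := Nat.cast_nonneg _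
  linarith

/-! ### Divisor bound and square-free sieve -/

theorem exists_card_divisors_le_rpow {ε : ℝ} (hε : 0 < ε) :
    ∃ C : ℝ, 1 ≤ C ∧ ∀ n : ℕ, n ≠ 0 → (n.divisors.card : ℝ) ≤ C * (n : ℝ) ^ ε := by
  set K : ℕ := ⌈(2 : ℝ) ^ (1 / ε)⌉₊ with hK
  set B : ℝ := max 1 (1 / (ε * Real.log 2)) with hB
  have hlog : 0 < Real.log 2 := Real.log_pos (by norm_num)
  have hB1 : 1 ≤ B := le_max_left _ _
  -- For `p ≥ 2^(1/ε)` one has `p^ε ≥ 2`, and `k + 1 ≤ 2^k` suffices. Each of the at most `K`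
  -- smaller primes costs a factor `B`, by Bernoulli's inequality.
  have hpk : ∀ p : ℕ, p.Prime → ∀ k : ℕ,
      ((k : ℝ) + 1) ≤ (if p < K then B else 1) * ((p : ℝ) ^ k) ^ ε := by
    intro p hp k
    have hp2 : (2 : ℝ) ≤ p := by exact_mod_cast hp.two_le
    have hcomm : ((p : ℝ) ^ k) ^ ε = ((p : ℝ) ^ ε) ^ k := by
      rw [← Real.rpow_natCast, ← Real.rpow_natCast, ← Real.rpow_mul (by positivity),
        ← Real.rpow_mul (by positivity), mul_comm]
    rw [hcomm]
    split_ifs with h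
    · have h1 : 1 + ε * Real.log 2 ≤ (p : ℝ) ^ ε := by
        calc 1 + ε * Real.log 2 ≤ Real.exp (ε * Real.log 2) := by
              rw [add_comm]; exact Real.add_one_le_exp _
          _ = (2 : ℝ) ^ ε := by rw [Real.rpow_def_of_pos (by norm_num), mul_comm]
          _ ≤ _ := Real.rpow_le_rpow (by norm_num) hp2 hε.le
      have h2 : 1 + k * (ε * Real.log 2) ≤ ((p : ℝ) ^ ε) ^ k :=
        (one_add_mul_le_pow (by nlinarith [mul_pos hε hlog]) k).trans
          (pow_le_pow_left₀ (by positivity) h1 k)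
      have h3 : 1 ≤ B * (ε * Real.log 2) := by
        have : 1 / (ε * Real.log 2) ≤ B := le_max_right _ _
        rwa [div_le_iff₀ (by positivity)] at this
      have h4 : (0 : ℝ) ≤ k := k.cast_nonneg
      calc (k : ℝ) + 1 ≤ B * (1 + k * (ε * Real.log 2)) := by nlinarith
        _ ≤ _ := mul_le_mul_of_nonneg_left h2 (by linarith)
    · have h1 : (2 : ℝ) ≤ (p : ℝ) ^ ε := by
        have h2 : (2 : ℝ) ^ (1 / ε) ≤ p := (Nat.le_ceil _).trans (by exact_mod_cast not_lt.1 h)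
        calc (2 : ℝ) = ((2 : ℝ) ^ (1 / ε)) ^ ε := by
              rw [← Real.rpow_mul (by norm_num), one_div_mul_cancel hε.ne', Real.rpow_one]
          _ ≤ _ := Real.rpow_le_rpow (by positivity) h2 hε.le
      rw [one_mul]
      calc (k : ℝ) + 1 ≤ (2 : ℝ) ^ k := by exact_mod_cast Nat.lt_two_pow_self
        _ ≤ _ := pow_le_pow_left₀ (by norm_num) h1 k
  refine ⟨B ^ K, one_le_pow₀ hB1, fun n hn => ?_⟩
  rw [Nat.card_divisors hn]
  push_cast
  calc ∏ p ∈ n.primeFactors, ((n.factorization p : ℝ) + 1)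
      ≤ ∏ p ∈ n.primeFactors, ((if p < K then B else 1) * ((p : ℝ) ^ n.factorization p) ^ ε) :=
        Finset.prod_le_prod (fun _ _ => by positivity)
          fun p hp => hpk p (Nat.prime_of_mem_primeFactors hp) _
    _ = (∏ p ∈ n.primeFactors, if p < K then B else 1) * (n : ℝ) ^ ε := by
        rw [Finset.prod_mul_distrib, Real.finsetProd_rpow _ _ (fun _ _ => by positivity)]
        congr 2
        conv_rhs => rw [← Nat.prod_factorization_pow_eq_self hn]
        rw [Finsupp.prod, Nat.support_factorization]
        push_cast; rfl
    _ ≤ B ^ K * (n : ℝ) ^ ε := by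
        refine mul_le_mul_of_nonneg_right ?_ (by positivity)
        rw [Finset.prod_ite, Finset.prod_const, Finset.prod_const_one, mul_one]
        refine pow_le_pow_right₀ hB1 ?_
        calc _ ≤ (Finset.range K).card := Finset.card_le_card fun p hp => by
              simpa using (Finset.mem_filter.1 hp).2
          _ = K := Finset.card_range K

theorem sq_dvd_sq_mul_squarefree_iff {a b d : ℕ} (ha : Squarefree a) (hb : b ≠ 0) :
    d ^ 2 ∣ b ^ 2 * a ↔ d ∣ b := by
  constructor
  · intro h
    have hg : 0 < d.gcd b := Nat.gcd_pos_of_pos_right _ (Nat.pos_of_ne_zero hb)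
    obtain ⟨d', b', hco, hd, hb'⟩ := Nat.exists_coprime d b
    set g := d.gcd b
    rw [hd, hb', mul_pow, mul_pow, mul_right_comm] at h
    have h1 := (Nat.mul_dvd_mul_iff_right (by positivity)).1 h
    have h2 : d' ^ 2 ∣ a := (Nat.Coprime.pow 2 2 hco).dvd_of_dvd_mul_left h1
    have h3 : d' = 1 := by simpa using ha d' (by rwa [← sq])
    rw [hd, h3, one_mul]; exact Nat.gcd_dvd_right _ _
  · intro h
    exact (pow_dvd_pow_of_dvd h 2).mul_right _

/-- With `N = b²a` and `a` square-free, `d² ∣ N` means `d ∣ b`, so this is `∑ μ(d)` over the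
divisors of `b`. The bound on `M` keeps all of them in range. -/
theorem sum_moebius_sq_dvd {N M : ℕ} (hN : N ≠ 0) (hM : N ≤ M ^ 2) :
    ∑ d ∈ (Finset.Icc 1 M).filter (fun d => d ^ 2 ∣ N), ArithmeticFunction.moebius d
      = if Squarefree N then 1 else 0 := by
  obtain ⟨a, b, hab, ha⟩ := Nat.sq_mul_squarefree N
  have hb : b ≠ 0 := by rintro rfl; simp at hab; exact hN hab.symm
  have hset : (Finset.Icc 1 M).filter (fun d => d ^ 2 ∣ N) = b.divisors := by
    ext d
    rw [Finset.mem_filter, ← hab, sq_dvd_sq_mul_squarefree_iff ha hb, Nat.mem_divisors,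
      Finset.mem_Icc]
    constructor
    · exact fun h => ⟨h.2, hb⟩
    · refine fun h => ⟨⟨Nat.pos_of_dvd_of_pos h.1 (Nat.pos_of_ne_zero hb), ?_⟩, h.1⟩
      refine (Nat.le_of_dvd (Nat.pos_of_ne_zero hb) h.1).trans ?_
      have ha1 : 1 ≤ a := Nat.pos_of_ne_zero ha.ne_zero
      exact (Nat.pow_le_pow_iff_left two_ne_zero).1 (by nlinarith)
  rw [hset, ← ArithmeticFunction.coe_mul_zeta_apply, ArithmeticFunction.moebius_mul_coe_zeta,
    ArithmeticFunction.one_apply]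
  congr 1
  rw [eq_iff_iff]
  constructor
  · rintro rfl; rw [← hab]; simpa using ha
  · intro h
    simpa using h b ⟨a, by rw [← hab]; ring⟩

/-! ### Residue classes in an interval -/

/-- The integers in `[X, X + Y]`. -/
noncomputable def natsIn (X Y : ℝ) : Finset ℕ := Finset.Icc ⌈X⌉₊ ⌊X + Y⌋₊

theorem mem_natsIn {X Y : ℝ} (hX : 0 < X) (hY : 0 ≤ Y) {N : ℕ} :
    N ∈ natsIn X Y ↔ X ≤ N ∧ (N : ℝ) ≤ X + Y := by
  rw [natsIn, Finset.mem_Icc, Nat.ceil_le, Nat.le_floor_iff (by positivity)]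

theorem abs_card_modEq_sub_le {X Y : ℝ} (hX : 0 < X) (hY : 0 ≤ Y) {m : ℕ} (hm : 0 < m) (v : ℕ) :
    |(((natsIn X Y).filter (fun N => N ≡ v [MOD m])).card : ℝ) - Y / m| ≤ 2 := by
  have hc : 1 ≤ ⌈X⌉₊ := Nat.one_le_ceil_iff.2 hX
  have he : natsIn X Y = Finset.Ioc (⌈X⌉₊ - 1) ⌊X + Y⌋₊ := by
    ext N; simp only [natsIn, Finset.mem_Icc, Finset.mem_Ioc]; omega
  have hk := Nat.Ioc_filter_modEq_card (⌈X⌉₊ - 1) ⌊X + Y⌋₊ hm v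
  rw [← he] at hk
  set k := ((natsIn X Y).filter (fun N => N ≡ v [MOD m])).card
  rw [Nat.cast_sub hc] at hk
  have h1 := Nat.le_ceil X
  have h2 := Nat.ceil_lt_add_one hX.le
  have h3 := Nat.floor_le (show 0 ≤ X + Y by positivity)
  have h4 := Nat.lt_floor_add_one (X + Y)
  set u : ℚ := ((⌊X + Y⌋₊ : ℚ) - v) / m with hu
  set w : ℚ := ((⌈X⌉₊ - ((1 : ℕ) : ℚ)) - v) / m with hw
  have f1 := Int.floor_le u
  have f2 := Int.lt_floor_add_one u
  have f3 := Int.floor_le w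
  have f4 := Int.lt_floor_add_one w
  have hmR : (1 : ℝ) ≤ m := by exact_mod_cast hm
  have huR : (u : ℝ) = ((⌊X + Y⌋₊ : ℝ) - v) / m := by rw [hu]; push_cast; rfl
  have hwR : (w : ℝ) = ((⌈X⌉₊ - 1 : ℝ) - v) / m := by rw [hw]; push_cast; rfl
  have f1' : ((⌊u⌋ : ℤ) : ℝ) ≤ u := by exact_mod_cast f1
  have f2' : (u : ℝ) < (⌊u⌋ : ℤ) + 1 := by exact_mod_cast f2
  have f3' : ((⌊w⌋ : ℤ) : ℝ) ≤ w := by exact_mod_cast f3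
  have f4' : (w : ℝ) < (⌊w⌋ : ℤ) + 1 := by exact_mod_cast f4
  have hkR : (k : ℝ) = max (((⌊u⌋ : ℤ) : ℝ) - (⌊w⌋ : ℤ)) 0 := by
    have : ((k : ℤ) : ℝ) = ((max (⌊u⌋ - ⌊w⌋) 0 : ℤ) : ℝ) := by exact_mod_cast hk
    push_cast at this
    exact this
  -- One unit of error comes from rounding the endpoints, the other from the two floors.
  have hd : |(u : ℝ) - w - Y / m| ≤ 1 := by
    rw [huR, hwR, ← sub_div, ← sub_div, abs_div, abs_of_pos (by linarith : (0 : ℝ) < m),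
      div_le_iff₀ (by linarith), abs_le]
    constructor <;> linarith
  rw [abs_le] at hd
  have hYm : 0 ≤ Y / m := by positivity
  rw [hkR, abs_le]
  rcases max_cases (((⌊u⌋ : ℤ) : ℝ) - (⌊w⌋ : ℤ)) 0 with ⟨h, h'⟩ | ⟨h, h'⟩ <;> rw [h] <;>
    constructor <;> linarith

/-- The number of `N` in an interval in a class modulo `m` with `a ∣ N + b`. -/
theorem abs_card_dvd_dvd_sub_le {X Y : ℝ} (hX : 0 < X) (hY : 0 ≤ Y) {m a : ℕ} (hm : 0 < m)
    (ha : 0 < a) {b : ℤ} (hb : ((Nat.gcd a m : ℕ) : ℤ) ∣ b) :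
    |(((natsIn X Y).filter (fun N => m ∣ N ∧ (a : ℤ) ∣ N + b)).card : ℝ) - Y / (Nat.lcm a m : ℕ)|
      ≤ 2 := by
  have hL : 0 < Nat.lcm a m := Nat.lcm_pos ha hm
  obtain ⟨t, ht⟩ := hb
  have hbez := Nat.gcd_eq_gcd_ab a m
  -- Bézout's identity supplies a common solution of both divisibilities; the others agree with it
  -- modulo the lcm.
  set v : ℤ := -(m * Nat.gcdB a m * t) with hv
  have hvm : (m : ℤ) ∣ v := ⟨-(Nat.gcdB a m * t), by rw [hv]; ring⟩
  have hva : (a : ℤ) ∣ v + b := ⟨Nat.gcdA a m * t, by rw [ht, hbez, hv]; ring⟩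
  have h0 := Int.emod_nonneg v (show ((Nat.lcm a m : ℕ) : ℤ) ≠ 0 by exact_mod_cast hL.ne')
  have hset : (natsIn X Y).filter (fun N => m ∣ N ∧ (a : ℤ) ∣ N + b)
      = (natsIn X Y).filter (fun N => N ≡ (v % (Nat.lcm a m : ℕ)).toNat [MOD Nat.lcm a m]) := by
    refine Finset.filter_congr fun N _ => ?_
    rw [← Int.natCast_modEq_iff, Int.toNat_of_nonneg h0]
    have e1 : ((N : ℤ) ≡ v % (Nat.lcm a m : ℕ) [ZMOD (Nat.lcm a m : ℕ)]) ↔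
        ((Nat.lcm a m : ℕ) : ℤ) ∣ N - v := by
      rw [Int.ModEq, Int.emod_emod_of_dvd _ dvd_rfl, eq_comm]
      exact Int.modEq_iff_dvd
    have e2 : ((Nat.lcm a m : ℕ) : ℤ) ∣ N - v ↔ (a : ℤ) ∣ N - v ∧ (m : ℤ) ∣ N - v := by
      rw [Int.natCast_dvd, Int.natCast_dvd, Int.natCast_dvd, Nat.lcm_dvd_iff]
    rw [e1, e2, ← Int.natCast_dvd_natCast, and_comm]
    refine and_congr ?_ ?_
    · rw [show (N : ℤ) + b = (N - v) + (v + b) by ring]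
      exact dvd_add_left hva
    · exact (dvd_sub_left hvm).symm
  rw [hset]
  exact abs_card_modEq_sub_le hX hY hL _

/-! ### Middle coefficients and the weight function -/

/-- The middle coefficients `β` of reduced forms `a x² + 2 β x y + c y²`, where the condition
`a ≤ c` is replaced by `a² - β² ≤ Z`. -/
noncomputable def middles (s : ℕ) (Z : ℝ) (a : ℕ) : Finset ℤ :=
  (Finset.Icc (-(a : ℤ)) a).filter (fun β => 2 * |β| + s ≤ a ∧ (a : ℝ) ^ 2 - (β : ℝ) ^ 2 ≤ Z)

/-- The proportion of residues modulo `t` that are middle coefficients. -/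
noncomputable def weight (Z t : ℝ) : ℝ := max 0 (1 - 2 * √(t ^ 2 - Z) / t)

/-- The multiples `rj` fill two mirror intervals `L ≤ ±j ≤ U`, meeting at most in `0`. The error `4`
is `2` for rounding, `1` for the overlap and `1` for replacing `2U` by `a / r`. -/
theorem abs_card_dvd_middles_sub_le {s : ℕ} (hs : s ≤ 1) (Z : ℝ) {a r : ℕ}
    (ha : 0 < a) (hr : 0 < r) :
    |(((middles s Z a).filter (fun β => (r : ℤ) ∣ β)).card : ℝ) - a * weight Z a / r| ≤ 4 := by
  have haR : (0 : ℝ) < a := by exact_mod_cast ha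
  have hrR : (1 : ℝ) ≤ r := by exact_mod_cast hr
  have hsR : (s : ℝ) ≤ 1 := by exact_mod_cast hs
  set L : ℝ := √((a : ℝ) ^ 2 - Z) / r with hLd
  set U : ℝ := ((a : ℝ) - s) / (2 * r) with hUd
  have hL0 : 0 ≤ L := by positivity
  have hv : a * weight Z a / r = max 0 (a / r - 2 * L) := by
    rw [weight, mul_div_right_comm, mul_max_of_nonneg _ _ (by positivity), mul_zero]
    congr 1
    rw [hLd]; field_simp
  set J : Finset ℤ := Finset.Icc ⌈L⌉ ⌊U⌋ with hJ
  have hmem : ∀ j : ℤ, (r : ℤ) * j ∈ middles s Z a ↔ L ≤ |(j : ℝ)| ∧ |(j : ℝ)| ≤ U := by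
    intro j
    have e1 : (2 * |(r : ℤ) * j| + s ≤ a) ↔ |(j : ℝ)| ≤ U := by
      rw [hUd, le_div_iff₀ (by positivity), abs_mul, Nat.abs_cast]
      rw [← @Int.cast_le ℝ]
      push_cast
      constructor <;> intro h <;> linarith
    have e2 : ((a : ℝ) ^ 2 - (((r : ℤ) * j : ℤ) : ℝ) ^ 2 ≤ Z) ↔ L ≤ |(j : ℝ)| := by
      rw [hLd, div_le_iff₀ (by positivity), Real.sqrt_le_left (by positivity), mul_pow, sq_abs]
      push_cast
      constructor <;> intro h <;> linarith
    rw [middles, Finset.mem_filter, e1, e2, Finset.mem_Icc]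
    constructor
    · exact fun h => ⟨h.2.2, h.2.1⟩
    · intro h
      have h3 := e1.2 h.2
      have h4 : |(r : ℤ) * j| ≤ a := by have := abs_nonneg ((r : ℤ) * j); omega
      exact ⟨abs_le.1 h4, h.2, h.1⟩
  have hcard : ((middles s Z a).filter (fun β => (r : ℤ) ∣ β))
      = (J ∪ J.image (fun j => -j)).image (fun j => (r : ℤ) * j) := by
    ext β
    simp only [Finset.mem_filter, Finset.mem_image, Finset.mem_union, hJ, Finset.mem_Icc,
      Int.ceil_le, Int.le_floor]
    constructor
    · rintro ⟨hβ, j, rfl⟩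
      have := (hmem j).1 hβ
      refine ⟨j, ?_, rfl⟩
      rcases abs_cases (j : ℝ) with ⟨h, h'⟩ | ⟨h, h'⟩
      · left; rwa [h] at this
      · right; exact ⟨-j, by push_cast; rwa [h] at this, by ring⟩
    · rintro ⟨j, hj, rfl⟩
      refine ⟨(hmem j).2 ?_, dvd_mul_right _ _⟩
      rcases hj with h | ⟨i, h, rfl⟩
      · rwa [abs_of_nonneg (hL0.trans h.1)]
      · push_cast; rwa [abs_neg, abs_of_nonneg (hL0.trans h.1)]
  have hinj : Function.Injective (fun j : ℤ => (r : ℤ) * j) :=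
    mul_right_injective₀ (by exact_mod_cast hr.ne')
  rw [hcard, Finset.card_image_of_injective _ hinj, hv]
  have hneg : (J.image (fun j => -j)).card = J.card :=
    Finset.card_image_of_injective _ neg_injective
  have hinter : (J ∩ J.image (fun j => -j)).card ≤ 1 := by
    refine Finset.card_le_one.2 ?_
    have : ∀ j ∈ J ∩ J.image (fun j => -j), j = 0 := by
      intro j hj
      simp only [Finset.mem_inter, Finset.mem_image, hJ, Finset.mem_Icc, Int.ceil_le] at hj
      obtain ⟨⟨h1, -⟩, i, ⟨h2, -⟩, rfl⟩ := hj
      have h3 : (0 : ℝ) ≤ i := hL0.trans h2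
      have h4 : (0 : ℝ) ≤ ((-i : ℤ) : ℝ) := hL0.trans h1
      have h3' : 0 ≤ i := by exact_mod_cast h3
      have h4' : 0 ≤ -i := by exact_mod_cast h4
      omega
    intro x hx y hy
    rw [this x hx, this y hy]
  have hunion := Finset.card_union_add_card_inter J (J.image (fun j => -j))
  rw [hneg] at hunion
  have hJc : (J.card : ℤ) = max (⌊U⌋ + 1 - ⌈L⌉) 0 := by
    rw [hJ, Int.card_Icc, Int.toNat_eq_max]
  have f1 := Int.floor_le U
  have f2 := Int.lt_floor_add_one U
  have f3 := Int.le_ceil L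
  have f4 := Int.ceil_lt_add_one L
  have hJR : (J.card : ℝ) = max (((⌊U⌋ : ℤ) : ℝ) + 1 - (⌈L⌉ : ℤ)) 0 := by
    have : ((J.card : ℤ) : ℝ) = ((max (⌊U⌋ + 1 - ⌈L⌉) 0 : ℤ) : ℝ) := by exact_mod_cast hJc
    push_cast at this
    exact this
  have hU2 : |2 * U - a / r| ≤ 1 := by
    have e : 2 * U - a / r = -(s / r) := by rw [hUd]; field_simp; ring
    rw [e, abs_neg, abs_of_nonneg (by positivity), div_le_one (by linarith)]
    linarith
  have hunR : ((J ∪ J.image (fun j => -j)).card : ℝ)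
      + ((J ∩ J.image (fun j => -j)).card : ℝ) = J.card + J.card := by exact_mod_cast hunion
  have hinR : ((J ∩ J.image (fun j => -j)).card : ℝ) ≤ 1 := by exact_mod_cast hinter
  have hin0 : (0 : ℝ) ≤ ((J ∩ J.image (fun j => -j)).card : ℝ) := Nat.cast_nonneg _
  rw [abs_le] at hU2 ⊢
  rcases max_cases (((⌊U⌋ : ℤ) : ℝ) + 1 - (⌈L⌉ : ℤ)) 0 with ⟨h, h'⟩ | ⟨h, h'⟩ <;>
  rcases max_cases (0 : ℝ) (a / r - 2 * L) with ⟨g, g'⟩ | ⟨g, g'⟩ <;>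
  rw [h] at hJR <;> rw [g] <;> constructor <;> linarith

theorem weight_le_one (Z : ℝ) {t : ℝ} (ht : 0 ≤ t) : weight Z t ≤ 1 := by
  refine max_le zero_le_one ?_
  have : 0 ≤ 2 * √(t ^ 2 - Z) / t := by positivity
  linarith

theorem weight_eq_one {Z t : ℝ} (h : t ^ 2 ≤ Z) : weight Z t = 1 := by
  rw [weight, Real.sqrt_eq_zero_of_nonpos (by linarith)]; simp

theorem weight_eq_zero {Z t : ℝ} (ht : 0 < t) (h : 4 * Z ≤ 3 * t ^ 2) : weight Z t = 0 := by
  refine max_eq_left ?_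
  have : t / 2 ≤ √(t ^ 2 - Z) := Real.le_sqrt_of_sq_le (by nlinarith)
  rw [sub_nonpos, le_div_iff₀ ht]
  linarith

/-- Beyond `√Z` the quotient is `√(1 - Z/t²)`, which increases. Monotonicity is what allows sums
over `a` to be compared with integrals. -/
theorem weight_antitoneOn {Z : ℝ} (hZ : 0 ≤ Z) : AntitoneOn (weight Z) (Set.Ici 0) := by
  intro x hx y hy hxy
  rcases eq_or_lt_of_le (show (0 : ℝ) ≤ x from hx) with rfl | hx0
  · rw [weight_eq_one (t := 0) (by simpa using hZ)]; exact weight_le_one Z hy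
  · have hy0 := hx0.trans_le hxy
    refine max_le_max le_rfl ?_
    have : √(x ^ 2 - Z) / x ≤ √(y ^ 2 - Z) / y := by
      rw [div_le_div_iff₀ hx0 hy0]
      refine abs_le_of_sq_le_sq' ?_ (by positivity) |>.2
      rw [mul_pow, mul_pow]
      rcases le_total (x ^ 2) Z with h | h
      · rw [Real.sqrt_eq_zero_of_nonpos (by linarith)]; simp; positivity
      · rw [Real.sq_sqrt (by linarith), Real.sq_sqrt (by nlinarith)]
        nlinarith [mul_nonneg hZ (show 0 ≤ y ^ 2 - x ^ 2 by nlinarith)]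
    rw [mul_div_assoc, mul_div_assoc]
    linarith

/-- The factor `π/3` is the hyperbolic area of the modular fundamental domain. The weight is `1` up
to `σ` and `0` beyond `2σ/√3`; in between, the arctangent in the antiderivative ends at `1/√3`. -/
theorem integral_weight {σ b : ℝ} (hσ : 0 < σ) (hb : 2 * σ ≤ b) :
    ∫ t in (0 : ℝ)..b, weight (σ ^ 2) t = Real.pi / 3 * σ := by
  have h3 : 0 < √(3 : ℝ) := by positivity
  have h3s : √(3 : ℝ) ^ 2 = 3 := Real.sq_sqrt (by norm_num)
  set τ : ℝ := 2 * σ / √3 with hτ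
  have hτ2 : τ ^ 2 = 4 / 3 * σ ^ 2 := by rw [hτ, div_pow, h3s]; ring
  have hτ0 : 0 < τ := by positivity
  have hστ : σ ≤ τ := abs_le_of_sq_le_sq' (by nlinarith) hτ0.le |>.2
  have hτb : τ ≤ b := (abs_le_of_sq_le_sq' (by nlinarith) (by linarith) |>.2)
  have hint : ∀ u v : ℝ, 0 ≤ u → 0 ≤ v →
      IntervalIntegrable (weight (σ ^ 2)) MeasureTheory.volume u v := by
    intro u v hu hv
    refine AntitoneOn.intervalIntegrable ((weight_antitoneOn (sq_nonneg σ)).mono ?_)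
    intro x hx
    exact (le_min hu hv).trans hx.1
  rw [← intervalIntegral.integral_add_adjacent_intervals (hint 0 σ le_rfl hσ.le)
      (hint σ b hσ.le (by linarith)),
    ← intervalIntegral.integral_add_adjacent_intervals (hint σ τ hσ.le hτ0.le)
      (hint τ b hτ0.le (by linarith))]
  have i1 : ∫ t in (0 : ℝ)..σ, weight (σ ^ 2) t = σ := by
    rw [intervalIntegral.integral_congr (g := fun _ => (1 : ℝ))]
    · simp
    · intro t ht
      rw [Set.uIcc_of_le hσ.le] at ht
      exact weight_eq_one (by nlinarith [ht.1, ht.2])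
  have i3 : ∫ t in τ..b, weight (σ ^ 2) t = 0 := by
    rw [intervalIntegral.integral_congr (g := fun _ => (0 : ℝ))]
    · simp
    · intro t ht
      rw [Set.uIcc_of_le hτb] at ht
      exact weight_eq_zero (hτ0.trans_le ht.1) (by nlinarith [ht.1, ht.2])
  have i2 : ∫ t in σ..τ, weight (σ ^ 2) t = Real.pi / 3 * σ - σ := by
    set F : ℝ → ℝ := fun t =>
      t - 2 * (√(t ^ 2 - σ ^ 2) - σ * Real.arctan (√(t ^ 2 - σ ^ 2) / σ)) with hF
    have hFc : Continuous F := by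
      rw [hF]
      have : Continuous fun t : ℝ => √(t ^ 2 - σ ^ 2) := by fun_prop
      exact continuous_id.sub (continuous_const.mul (this.sub
        (continuous_const.mul (Real.continuous_arctan.comp (this.div_const σ)))))
    rw [intervalIntegral.integral_eq_sub_of_hasDerivAt_of_le hστ hFc.continuousOn ?_
      (hint σ τ hσ.le hτ0.le)]
    · have e1 : √(τ ^ 2 - σ ^ 2) = σ * (√3)⁻¹ := by
        rw [hτ2, show 4 / 3 * σ ^ 2 - σ ^ 2 = (σ * (√3)⁻¹) ^ 2 by
          rw [mul_pow, inv_pow, h3s]; ring]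
        exact Real.sqrt_sq (by positivity)
      simp only [hF, e1, sub_self, Real.sqrt_zero, zero_div, Real.arctan_zero, mul_zero]
      rw [mul_div_cancel_left₀ _ hσ.ne', Real.arctan_inv_sqrt_three, hτ]
      field_simp; ring
    · intro t ht
      have ht0 : 0 < t := hσ.trans ht.1
      have hpos : 0 < t ^ 2 - σ ^ 2 := by nlinarith [ht.1]
      set w := √(t ^ 2 - σ ^ 2) with hw
      have hw0 : 0 < w := Real.sqrt_pos.2 hpos
      have hw2 : w ^ 2 = t ^ 2 - σ ^ 2 := Real.sq_sqrt hpos.le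
      have d1 : HasDerivAt (fun t : ℝ => √(t ^ 2 - σ ^ 2)) (t / w) t := by
        have := ((hasDerivAt_pow 2 t).sub_const (σ ^ 2)).sqrt hpos.ne'
        convert this using 1
        rw [← hw]; push_cast; field_simp
      have d2 := ((d1.div_const σ).arctan).const_mul σ
      have d3 := (hasDerivAt_id t).sub ((d1.sub d2).const_mul 2)
      have hval : weight (σ ^ 2) t = 1 - 2 * w / t := by
        refine max_eq_right ?_
        rw [sub_nonneg, div_le_one ht0]
        have : t ^ 2 ≤ τ ^ 2 := by nlinarith [ht.2]
        exact abs_le_of_sq_le_sq' (by nlinarith) ht0.le |>.2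
      rw [hval]
      refine d3.congr_deriv ?_
      rw [← hw]
      have e : (1 : ℝ) + (w / σ) ^ 2 = t ^ 2 / σ ^ 2 := by
        rw [div_pow, hw2]; field_simp; ring
      rw [e]
      field_simp
      linear_combination 2 * hw2
  rw [i1, i2, i3]; ring

/-! ### Compatibility of `d² ∣ N` with `a ∣ N + β²` -/

theorem gcd_sq_eq {a d : ℕ} (ha : 0 < a) :
    Nat.gcd a (d ^ 2) = Nat.gcd a d * Nat.gcd (a / Nat.gcd a d) (Nat.gcd a d) := by
  have hr : 0 < Nat.gcd a d := Nat.gcd_pos_of_pos_left _ ha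
  obtain ⟨a', d', hco, ha', hd'⟩ := Nat.exists_coprime a d
  set r := Nat.gcd a d
  have h1 : a / r = a' := by rw [ha']; exact Nat.mul_div_cancel _ hr
  rw [h1]
  conv_lhs => rw [ha', hd']
  rw [show (d' * r) ^ 2 = (r * d' ^ 2) * r by ring, Nat.gcd_mul_right, mul_comm]
  congr 1
  exact Nat.Coprime.gcd_mul_right_cancel_right r (hco.symm.pow_left 2)

/-- This is the condition on `β` for the two divisibilities to be compatible. The gcd is `r g` with
`r = gcd(a, d)` square-free and `g ∣ r`: from `r ∣ β²` follows `r ∣ β`, and conversely `r ∣ β` gives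
`r g ∣ β²`. -/
theorem gcd_sq_dvd_sq_iff {a d : ℕ} (ha : 0 < a) (hd : Squarefree d) (β : ℤ) :
    ((Nat.gcd a (d ^ 2) : ℕ) : ℤ) ∣ β ^ 2 ↔ ((Nat.gcd a d : ℕ) : ℤ) ∣ β := by
  rw [gcd_sq_eq ha]
  constructor
  · intro h
    have h1 : Squarefree ((Nat.gcd a d : ℕ) : ℤ) :=
      Int.squarefree_natCast.2 (hd.squarefree_of_dvd (Nat.gcd_dvd_right _ _))
    rw [← h1.dvd_pow_iff_dvd two_ne_zero]
    exact (by push_cast; exact dvd_mul_right _ _ : ((Nat.gcd a d : ℕ) : ℤ) ∣ _).trans h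
  · intro h
    rw [sq, Nat.cast_mul]
    refine mul_dvd_mul h (dvd_trans ?_ h)
    exact Int.natCast_dvd_natCast.2 (Nat.gcd_dvd_right _ _)

/-- From `n = ∑ φ(e)` over `e ∣ n`. The dependence on `a` thereby becomes the divisibility `e² ∣ a`,
suited to summation over `a`. -/
theorem gcd_div_gcd_eq_sum_totient {a d : ℕ} (ha : 0 < a) (hd : Squarefree d) :
    Nat.gcd (a / Nat.gcd a d) (Nat.gcd a d)
      = ∑ e ∈ d.divisors.filter (fun e => e ^ 2 ∣ a), e.totient := by
  have hr : 0 < Nat.gcd a d := Nat.gcd_pos_of_pos_left _ ha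
  have har : Nat.gcd a d * (a / Nat.gcd a d) = a := Nat.mul_div_cancel' (Nat.gcd_dvd_left _ _)
  have hrs : Squarefree (Nat.gcd a d) := hd.squarefree_of_dvd (Nat.gcd_dvd_right _ _)
  have hrd : Nat.gcd a d ∣ d := Nat.gcd_dvd_right _ _
  have hrdiv : ∀ e, e ∣ a → e ∣ d → e ∣ Nat.gcd a d := fun e => Nat.dvd_gcd
  set r := Nat.gcd a d
  rw [← Nat.sum_totient (Nat.gcd (a / r) r)]
  refine Finset.sum_congr ?_ fun _ _ => rfl
  ext e
  rw [Nat.mem_divisors, Finset.mem_filter, Nat.mem_divisors]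
  constructor
  · rintro ⟨h, -⟩
    have h1 := h.trans (Nat.gcd_dvd_left _ _)
    have h2 := h.trans (Nat.gcd_dvd_right _ _)
    exact ⟨⟨h2.trans hrd, hd.ne_zero⟩, by rw [sq, ← har]; exact mul_dvd_mul h2 h1⟩
  · rintro ⟨⟨h1, -⟩, h2⟩
    have her : e ∣ r := hrdiv e ((dvd_pow_self e two_ne_zero).trans h2) h1
    refine ⟨Nat.dvd_gcd ?_ her, (Nat.gcd_pos_of_pos_right _ hr).ne'⟩
    obtain ⟨k, hk⟩ := her
    have he : 0 < e := Nat.pos_of_ne_zero (by rintro rfl; simp at hk; omega)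
    have hco : Nat.Coprime e k := Nat.coprime_of_squarefree_mul (hk ▸ hrs)
    rw [← har, hk, sq, mul_assoc] at h2
    rw [hk]
    exact hco.dvd_of_dvd_mul_left ((Nat.mul_dvd_mul_iff_left he).1 h2)

/-! ### Pairs `(a, β)` on average over `N` -/

/-- The number of reduced forms `a x² + 2 β x y + c y²` with `a ≤ A` and `a c - β² = N`, where
the condition `a ≤ c` is replaced by `a² - β² ≤ Z`. -/
noncomputable def pairCount (s : ℕ) (Z : ℝ) (A N : ℕ) : ℕ :=
  ∑ a ∈ Finset.Icc 1 A, ((middles s Z a).filter (fun β => (a : ℤ) ∣ (N : ℤ) + β ^ 2)).card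

theorem card_middles_le (s : ℕ) (Z : ℝ) (a : ℕ) : ((middles s Z a).card : ℝ) ≤ 2 * a + 1 := by
  have h := Finset.card_filter_le (Finset.Icc (-(a : ℤ)) a)
    (fun β => 2 * |β| + s ≤ a ∧ (a : ℝ) ^ 2 - (β : ℝ) ^ 2 ≤ Z)
  rw [Int.card_Icc] at h
  have h2 : (middles s Z a).card ≤ 2 * a + 1 := h.trans (by omega)
  exact_mod_cast h2

theorem sum_pairCount_eq (s : ℕ) (Z : ℝ) (A m : ℕ) (S : Finset ℕ) :
    ∑ N ∈ S.filter (fun N => m ∣ N), pairCount s Z A N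
      = ∑ a ∈ Finset.Icc 1 A, ∑ β ∈ middles s Z a,
          (S.filter (fun N => m ∣ N ∧ (a : ℤ) ∣ (N : ℤ) + β ^ 2)).card := by
  simp only [pairCount]
  rw [Finset.sum_comm]
  refine Finset.sum_congr rfl fun a _ => ?_
  simp_rw [← Finset.filter_filter, Finset.card_filter]
  rw [Finset.sum_comm]

/-- Only `β` divisible by `r` contribute: about `a · weight / r` of them, each with about `Y / L`
values of `N`, and `r G L = a d²`. The error is `4` in the number of `β`, times `Y / a`, plus `2`
for each of at most `2a + 1` progressions. -/
theorem abs_sum_card_sub_le {s : ℕ} (hs : s ≤ 1) {X Y : ℝ} (hX : 0 < X) (hY : 0 ≤ Y) (Z : ℝ)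
    {a d : ℕ} (ha : 0 < a) (hd : Squarefree d) :
    |((∑ β ∈ middles s Z a,
        ((natsIn X Y).filter (fun N => d ^ 2 ∣ N ∧ (a : ℤ) ∣ (N : ℤ) + β ^ 2)).card : ℕ) : ℝ)
      - Y / d ^ 2 * (((∑ e ∈ d.divisors.filter (fun e => e ^ 2 ∣ a), e.totient : ℕ) : ℝ)
        * weight Z a)| ≤ 4 * (Y / a) + 2 * (2 * a + 1) := by
  have hd0 : 0 < d := Nat.pos_of_ne_zero hd.ne_zero
  have haR : (0 : ℝ) < a := by exact_mod_cast ha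
  have hdR : (0 : ℝ) < d := by exact_mod_cast hd0
  have hr : 0 < Nat.gcd a d := Nat.gcd_pos_of_pos_left _ ha
  have hL : 0 < Nat.lcm a (d ^ 2) := Nat.lcm_pos ha (by positivity)
  have hmul : Nat.gcd a (d ^ 2) * Nat.lcm a (d ^ 2) = a * d ^ 2 := Nat.gcd_mul_lcm _ _
  rw [gcd_sq_eq ha, gcd_div_gcd_eq_sum_totient ha hd] at hmul
  set G := ∑ e ∈ d.divisors.filter (fun e => e ^ 2 ∣ a), e.totient
  set r := Nat.gcd a d with hrdef
  set L := Nat.lcm a (d ^ 2) with hLdef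
  set f : ℤ → ℕ := fun β =>
    ((natsIn X Y).filter (fun N => d ^ 2 ∣ N ∧ (a : ℤ) ∣ (N : ℤ) + β ^ 2)).card with hf
  set M := (middles s Z a).filter (fun β => (r : ℤ) ∣ β) with hM
  have hzero : ∀ β ∈ middles s Z a, β ∉ M → f β = 0 := by
    intro β hβ hβM
    have hβr : ¬ (r : ℤ) ∣ β := fun h => hβM (Finset.mem_filter.2 ⟨hβ, h⟩)
    rw [hf, Finset.card_eq_zero, Finset.filter_eq_empty_iff]
    rintro N - ⟨h1, h2⟩
    refine hβr ((gcd_sq_dvd_sq_iff ha hd β).1 ?_)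
    have h3 : ((Nat.gcd a (d ^ 2) : ℕ) : ℤ) ∣ (N : ℤ) :=
      Int.natCast_dvd_natCast.2 ((Nat.gcd_dvd_right _ _).trans h1)
    have h4 : ((Nat.gcd a (d ^ 2) : ℕ) : ℤ) ∣ (N : ℤ) + β ^ 2 :=
      (Int.natCast_dvd_natCast.2 (Nat.gcd_dvd_left _ _)).trans h2
    exact (dvd_add_right h3).1 h4
  have hsum : ∑ β ∈ middles s Z a, f β = ∑ β ∈ M, f β :=
    (Finset.sum_subset (Finset.filter_subset _ _) hzero).symm
  have hLR : (a : ℝ) ≤ L := by exact_mod_cast Nat.le_of_dvd hL (Nat.dvd_lcm_left _ _)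
  have hrR : (0 : ℝ) < r := by exact_mod_cast hr
  have hmulR : (r : ℝ) * G * L = a * d ^ 2 := by exact_mod_cast hmul
  have hYL : Y / L ≤ Y / a := div_le_div_of_nonneg_left hY haR hLR
  have hmain : Y / d ^ 2 * ((G : ℝ) * weight Z a) = (a * weight Z a / r) * (Y / L) := by
    have hL0 : (0 : ℝ) < L := haR.trans_le hLR
    field_simp
    linear_combination weight Z a * Y * hmulR
  have h1 : |((∑ β ∈ M, f β : ℕ) : ℝ) - M.card * (Y / L)| ≤ 2 * (2 * a + 1) := by
    push_cast
    rw [← nsmul_eq_mul, ← Finset.sum_const, ← Finset.sum_sub_distrib]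
    refine (Finset.abs_sum_le_sum_abs _ _).trans ?_
    calc ∑ β ∈ M, |(f β : ℝ) - Y / L| ≤ ∑ β ∈ M, (2 : ℝ) := by
          refine Finset.sum_le_sum fun β hβ => ?_
          exact abs_card_dvd_dvd_sub_le hX hY (by positivity) ha
            ((gcd_sq_dvd_sq_iff ha hd β).2 (Finset.mem_filter.1 hβ).2)
      _ = 2 * M.card := by rw [Finset.sum_const, nsmul_eq_mul, mul_comm]
      _ ≤ 2 * (middles s Z a).card := by
          have : M.card ≤ (middles s Z a).card := Finset.card_filter_le _ _
          have : (M.card : ℝ) ≤ (middles s Z a).card := by exact_mod_cast this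
          linarith
      _ ≤ _ := by linarith [card_middles_le s Z a]
  have h2 := abs_card_dvd_middles_sub_le hs Z ha hr
  rw [← hM] at h2
  have hYL0 : 0 ≤ Y / L := by positivity
  have h3 : |(M.card : ℝ) * (Y / L) - (a * weight Z a / r) * (Y / L)| ≤ 4 * (Y / a) := by
    rw [← sub_mul, abs_mul, abs_of_nonneg hYL0]
    calc _ ≤ 4 * (Y / L) := mul_le_mul_of_nonneg_right h2 hYL0
      _ ≤ _ := by linarith
  rw [hsum, hmain]
  calc _ = |(((∑ β ∈ M, f β : ℕ) : ℝ) - M.card * (Y / L)) +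
        ((M.card : ℝ) * (Y / L) - (a * weight Z a / r) * (Y / L))| := by ring_nf
    _ ≤ _ := (abs_add_le _ _).trans (by linarith)

theorem abs_sum_weight_sub_le {σ : ℝ} (hσ : 0 < σ) {A m : ℕ} (hA : 2 * σ ≤ A) (hm : 0 < m) :
    |∑ a ∈ (Finset.Icc 1 A).filter (fun a => m ∣ a), weight (σ ^ 2) a - Real.pi / 3 * σ / m|
      ≤ 1 := by
  have hmR : (0 : ℝ) < m := by exact_mod_cast hm
  -- One step past the last multiple of `m`, where the weight already vanishes; sum and integral of
  -- a decreasing function then differ by at most its initial value.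
  set n := A / m + 1 with hn
  set f : ℝ → ℝ := fun t => weight (σ ^ 2) (m * t) with hf
  have hAn : A < m * n := by rw [hn]; exact Nat.lt_mul_div_succ A hm
  have hAnR : (A : ℝ) ≤ m * n := by exact_mod_cast hAn.le
  have hanti : AntitoneOn f (Set.Icc 0 (0 + (n : ℝ))) := by
    intro x hx y hy hxy
    exact weight_antitoneOn (sq_nonneg σ) (mul_nonneg hmR.le hx.1) (mul_nonneg hmR.le hy.1)
      (mul_le_mul_of_nonneg_left hxy hmR.le)
  have h1 := hanti.sum_le_integral
  have h2 := hanti.integral_le_sum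
  simp only [zero_add] at h1 h2
  have hI : ∫ t in (0 : ℝ)..n, f t = Real.pi / 3 * σ / m := by
    rw [hf, intervalIntegral.integral_comp_mul_left (weight (σ ^ 2)) hmR.ne', mul_zero,
      integral_weight hσ (hA.trans hAnR), smul_eq_mul]
    field_simp
  have hfn : f n = 0 := by
    have : 2 * σ ≤ m * n := hA.trans hAnR
    exact weight_eq_zero (by linarith) (by nlinarith)
  have hS : ∑ a ∈ (Finset.Icc 1 A).filter (fun a => m ∣ a), weight (σ ^ 2) a
      = ∑ i ∈ Finset.range n, f ((i + 1 : ℕ) : ℝ) := by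
    rw [hn, Finset.sum_range_succ, ← hn, hfn, add_zero]
    have himg : (Finset.Icc 1 A).filter (fun a => m ∣ a)
        = (Finset.range (A / m)).image (fun i => m * (i + 1)) := by
      ext a
      simp only [Finset.mem_filter, Finset.mem_Icc, Finset.mem_image, Finset.mem_range]
      constructor
      · rintro ⟨⟨h1, h2⟩, k, rfl⟩
        have hk : 0 < k := Nat.pos_of_ne_zero (by rintro rfl; simp at h1)
        refine ⟨k - 1, ?_, by rw [Nat.sub_add_cancel hk]⟩
        have : k ≤ A / m := (Nat.le_div_iff_mul_le hm).2 (by rwa [mul_comm])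
        omega
      · rintro ⟨i, hi, rfl⟩
        refine ⟨⟨Nat.mul_pos hm (Nat.succ_pos i), ?_⟩, dvd_mul_right _ _⟩
        rw [mul_comm]
        exact (Nat.le_div_iff_mul_le hm).1 hi
    rw [himg, Finset.sum_image (fun x _ y _ h => by
      have := Nat.eq_of_mul_eq_mul_left hm h; omega)]
    refine Finset.sum_congr rfl fun i _ => ?_
    rw [hf]; push_cast; rfl
  have hshift : ∑ i ∈ Finset.range n, f (i : ℝ)
      = f 0 + ∑ i ∈ Finset.range n, f ((i + 1 : ℕ) : ℝ) := by
    have e1 := Finset.sum_range_succ (fun i : ℕ => f (i : ℝ)) n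
    have e2 := Finset.sum_range_succ' (fun i : ℕ => f (i : ℝ)) n
    rw [e1, hfn, add_zero] at e2
    rw [e2, add_comm]; simp
  have hf0 : f 0 ≤ 1 := weight_le_one _ (by simp)
  rw [hS, abs_le]
  rw [hI] at h1 h2
  constructor <;> linarith

/-- The density, in units of the volume, of pairs (form, square multiple of `d²`). -/
noncomputable def sqDensity (d : ℕ) : ℝ := (∑ e ∈ d.divisors, (e.totient : ℝ) / e ^ 2) / d ^ 2

/-- After exchanging sums, each `e` carries an error at most `φ(e)`, and these add up to `d`. -/
theorem abs_sum_totient_weight_sub_le {σ : ℝ} (hσ : 0 < σ) {A d : ℕ} (hA : 2 * σ ≤ A) :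
    |∑ a ∈ Finset.Icc 1 A,
        ((∑ e ∈ d.divisors.filter (fun e => e ^ 2 ∣ a), e.totient : ℕ) : ℝ) * weight (σ ^ 2) a
      - Real.pi / 3 * σ * ∑ e ∈ d.divisors, (e.totient : ℝ) / e ^ 2| ≤ d := by
  have hswap : ∑ a ∈ Finset.Icc 1 A,
        ((∑ e ∈ d.divisors.filter (fun e => e ^ 2 ∣ a), e.totient : ℕ) : ℝ) * weight (σ ^ 2) a
      = ∑ e ∈ d.divisors, (e.totient : ℝ) *
          ∑ a ∈ (Finset.Icc 1 A).filter (fun a => e ^ 2 ∣ a), weight (σ ^ 2) a := by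
    push_cast
    simp_rw [Finset.sum_mul, Finset.mul_sum, Finset.sum_filter]
    rw [Finset.sum_comm]
  rw [hswap, Finset.mul_sum, ← Finset.sum_sub_distrib]
  refine (Finset.abs_sum_le_sum_abs _ _).trans ?_
  calc _ ≤ ∑ e ∈ d.divisors, (e.totient : ℝ) := by
        refine Finset.sum_le_sum fun e he => ?_
        have h := abs_sum_weight_sub_le hσ hA
          (show 0 < e ^ 2 from pow_pos (Nat.pos_of_mem_divisors he) 2)
        rw [show Real.pi / 3 * σ * ((e.totient : ℝ) / e ^ 2)
          = (e.totient : ℝ) * (Real.pi / 3 * σ / ((e ^ 2 : ℕ) : ℝ)) by push_cast; ring,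
          ← mul_sub, abs_mul, abs_of_nonneg (Nat.cast_nonneg _)]
        exact mul_le_of_le_one_right (Nat.cast_nonneg _) h
    _ = d := by exact_mod_cast Nat.sum_totient d

theorem abs_sum_pairCount_sub_le {s : ℕ} (hs : s ≤ 1) {X Y σ : ℝ} (hX : 0 < X) (hY : 0 ≤ Y)
    (hσ : 0 < σ) {A d : ℕ} (hA : 2 * σ ≤ A) (hd : Squarefree d) :
    |((∑ N ∈ (natsIn X Y).filter (fun N => d ^ 2 ∣ N), pairCount s (σ ^ 2) A N : ℕ) : ℝ)
      - Real.pi / 3 * Y * σ * sqDensity d|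
      ≤ Y + 4 * Y * (1 + Real.log A) + 2 * A * (2 * A + 1) := by
  have hd0 : 0 < d := Nat.pos_of_ne_zero hd.ne_zero
  have hdR : (1 : ℝ) ≤ d := by exact_mod_cast hd0
  set W : ℝ := ∑ a ∈ Finset.Icc 1 A,
    ((∑ e ∈ d.divisors.filter (fun e => e ^ 2 ∣ a), e.totient : ℕ) : ℝ) * weight (σ ^ 2) a with hW
  have h1 : |((∑ N ∈ (natsIn X Y).filter (fun N => d ^ 2 ∣ N), pairCount s (σ ^ 2) A N : ℕ) : ℝ)
      - Y / d ^ 2 * W| ≤ ∑ a ∈ Finset.Icc 1 A, (4 * (Y / a) + 2 * (2 * a + 1)) := by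
    rw [sum_pairCount_eq, Nat.cast_sum, hW, Finset.mul_sum, ← Finset.sum_sub_distrib]
    refine (Finset.abs_sum_le_sum_abs _ _).trans (Finset.sum_le_sum fun a ha => ?_)
    exact abs_sum_card_sub_le hs hX hY _ (Finset.mem_Icc.1 ha).1 hd
  have h2 : ∑ a ∈ Finset.Icc 1 A, (4 * (Y / a) + 2 * (2 * a + 1))
      ≤ 4 * Y * (1 + Real.log A) + 2 * A * (2 * A + 1) := by
    rw [Finset.sum_add_distrib]
    refine add_le_add ?_ ?_
    · have hh := harmonic_le_one_add_log A
      rw [harmonic_eq_sum_Icc] at hh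
      push_cast at hh
      calc ∑ a ∈ Finset.Icc 1 A, 4 * (Y / (a : ℝ)) = 4 * Y * ∑ a ∈ Finset.Icc 1 A, ((a : ℝ))⁻¹ := by
            rw [Finset.mul_sum]; exact Finset.sum_congr rfl fun a _ => by ring
        _ ≤ _ := mul_le_mul_of_nonneg_left hh (by positivity)
    · calc ∑ a ∈ Finset.Icc 1 A, 2 * (2 * (a : ℝ) + 1)
          ≤ ∑ a ∈ Finset.Icc 1 A, 2 * (2 * (A : ℝ) + 1) := by
            refine Finset.sum_le_sum fun a ha => ?_
            have : (a : ℝ) ≤ A := by exact_mod_cast (Finset.mem_Icc.1 ha).2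
            linarith
        _ = _ := by rw [Finset.sum_const, Nat.card_Icc, nsmul_eq_mul]; push_cast; ring
  have h3 : |Y / d ^ 2 * W - Real.pi / 3 * Y * σ * sqDensity d| ≤ Y := by
    have e : Y / d ^ 2 * W - Real.pi / 3 * Y * σ * sqDensity d
        = Y / d ^ 2 * (W - Real.pi / 3 * σ * ∑ e ∈ d.divisors, (e.totient : ℝ) / e ^ 2) := by
      rw [sqDensity]; ring
    rw [e, abs_mul, abs_of_nonneg (by positivity)]
    calc _ ≤ Y / d ^ 2 * d :=
          mul_le_mul_of_nonneg_left (abs_sum_totient_weight_sub_le hσ hA) (by positivity)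
      _ = Y / d := by field_simp
      _ ≤ Y := div_le_self hY hdR
  calc _ = |(((∑ N ∈ (natsIn X Y).filter (fun N => d ^ 2 ∣ N), pairCount s (σ ^ 2) A N : ℕ) : ℝ)
      - Y / d ^ 2 * W) + (Y / d ^ 2 * W - Real.pi / 3 * Y * σ * sqDensity d)| := by ring_nf
    _ ≤ _ := (abs_add_le _ _).trans (by linarith)

/-! ### The density series and its Euler product -/

theorem sqDensity_nonneg (d : ℕ) : 0 ≤ sqDensity d := by unfold sqDensity; positivity

theorem sqDensity_le (d : ℕ) : sqDensity d ≤ d.divisors.card / (d : ℝ) ^ 2 := by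
  refine div_le_div_of_nonneg_right ?_ (by positivity)
  rw [Finset.cast_card]
  refine Finset.sum_le_sum fun e he => ?_
  have he : (1 : ℝ) ≤ e := by exact_mod_cast Nat.pos_of_mem_divisors he
  have h : (e.totient : ℝ) ≤ e := by exact_mod_cast Nat.totient_le e
  rw [div_le_one (by positivity)]
  nlinarith

/-- The terms of the series for the density of square-free numbers, weighted by class numbers. -/
noncomputable def densityTerm (d : ℕ) : ℝ := (ArithmeticFunction.moebius d : ℝ) * sqDensity d

theorem abs_densityTerm_le (d : ℕ) : |densityTerm d| ≤ sqDensity d := by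
  rw [densityTerm, abs_mul, abs_of_nonneg (sqDensity_nonneg d)]
  refine mul_le_of_le_one_left (sqDensity_nonneg d) ?_
  exact_mod_cast ArithmeticFunction.abs_moebius_le_one

theorem exists_sqDensity_le_rpow {ε : ℝ} (hε : 0 < ε) :
    ∃ C : ℝ, 0 < C ∧ ∀ d : ℕ, d ≠ 0 → sqDensity d ≤ C * (d : ℝ) ^ (ε - 2) := by
  obtain ⟨C, hC, h⟩ := exists_card_divisors_le_rpow hε
  refine ⟨C, by linarith, fun d hd => (sqDensity_le d).trans ?_⟩
  have hdR : (0 : ℝ) < d := by positivity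
  rw [Real.rpow_sub hdR, Real.rpow_two, ← mul_div_assoc]
  exact div_le_div_of_nonneg_right (h d hd) (by positivity)

theorem summable_abs_densityTerm : Summable (fun d => |densityTerm d|) := by
  obtain ⟨C, hC, h⟩ := exists_sqDensity_le_rpow (ε := 1 / 2) (by norm_num)
  refine Summable.of_nonneg_of_le (fun _ => abs_nonneg _) (fun d => ?_)
    ((Real.summable_nat_rpow.2 (show (1 / 2 - 2 : ℝ) < -1 by norm_num)).mul_left C)
  by_cases hd : d = 0
  · subst hd; simp [densityTerm]; positivity
  · exact (abs_densityTerm_le d).trans (h d hd)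

theorem exists_abs_sum_densityTerm_sub_tsum_le {ε : ℝ} (hε : 0 < ε) (hε1 : ε ≤ 1) :
    ∃ C : ℝ, 0 < C ∧ ∀ D : ℕ, ∀ R : ℝ, 1 ≤ R → R ≤ D + 1 →
      |∑ d ∈ Finset.Icc 1 D, densityTerm d - ∑' d, densityTerm d| ≤ C * R ^ (ε - 1) := by
  obtain ⟨C, hC, h⟩ := exists_sqDensity_le_rpow (ε := ε / 2) (by linarith)
  have hsum : Summable (fun d : ℕ => (d : ℝ) ^ (-1 - ε / 2)) :=
    Real.summable_nat_rpow.2 (by linarith)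
  have hS0 : 0 ≤ ∑' d : ℕ, (d : ℝ) ^ (-1 - ε / 2) := tsum_nonneg fun d => by positivity
  refine ⟨C * (∑' d : ℕ, (d : ℝ) ^ (-1 - ε / 2) + 1), by positivity, fun D R hR hRD => ?_⟩
  have hsd : Summable densityTerm := summable_abs_densityTerm.of_abs
  have e1 : ∑ d ∈ Finset.Icc 1 D, densityTerm d = ∑ d ∈ Finset.range (D + 1), densityTerm d := by
    have : Finset.range (D + 1) = insert 0 (Finset.Icc 1 D) := by
      ext d; simp only [Finset.mem_range, Finset.mem_insert, Finset.mem_Icc]; omega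
    rw [this, Finset.sum_insert (by simp)]
    simp [densityTerm]
  have hshift := hsd.sum_add_tsum_nat_add (D + 1)
  have e2 : ∑ d ∈ Finset.Icc 1 D, densityTerm d - ∑' d, densityTerm d
      = -∑' i, densityTerm (i + (D + 1)) := by rw [e1, ← hshift]; ring
  have hRpos : 0 < R := by linarith
  have hsum' : Summable (fun i : ℕ => ((i + (D + 1) : ℕ) : ℝ) ^ (-1 - ε / 2)) :=
    (summable_nat_add_iff (f := fun d : ℕ => (d : ℝ) ^ (-1 - ε / 2)) (D + 1)).2 hsum
  have hle : ∑' i : ℕ, ((i + (D + 1) : ℕ) : ℝ) ^ (-1 - ε / 2)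
      ≤ ∑' d : ℕ, (d : ℝ) ^ (-1 - ε / 2) := by
    rw [← hsum.sum_add_tsum_nat_add (D + 1)]
    exact le_add_of_nonneg_left (Finset.sum_nonneg fun _ _ => by positivity)
  have habs : Summable (fun i => |densityTerm (i + (D + 1))|) :=
    (summable_nat_add_iff (f := fun d => |densityTerm d|) (D + 1)).2 summable_abs_densityTerm
  rw [e2, abs_neg]
  calc |∑' i, densityTerm (i + (D + 1))| ≤ ∑' i, |densityTerm (i + (D + 1))| := by
        simpa [Real.norm_eq_abs] using norm_tsum_le_tsum_norm (f := fun i => densityTerm (i + (D + 1)))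
          (by simpa [Real.norm_eq_abs] using habs)
    _ ≤ ∑' i : ℕ, C * R ^ (ε - 1) * ((i + (D + 1) : ℕ) : ℝ) ^ (-1 - ε / 2) := by
        refine habs.tsum_le_tsum (fun i => ?_) (hsum'.mul_left _)
        have hdR : R ≤ ((i + (D + 1) : ℕ) : ℝ) := by
          push_cast; have : (0 : ℝ) ≤ i := i.cast_nonneg; linarith
        have hd0 : (0 : ℝ) < ((i + (D + 1) : ℕ) : ℝ) := by linarith
        refine (abs_densityTerm_le _).trans ((h _ (by omega)).trans ?_)
        -- The factor `d^(ε-1)` supplies the decay in `R`; `d^(-1-ε/2)` keeps the series convergent.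
        rw [show ε / 2 - 2 = (ε - 1) + (-1 - ε / 2) by ring, Real.rpow_add hd0, ← mul_assoc]
        refine mul_le_mul_of_nonneg_right ?_ (by positivity)
        refine mul_le_mul_of_nonneg_left ?_ hC.le
        exact Real.rpow_le_rpow_of_nonpos hRpos hdR (by linarith)
    _ = C * R ^ (ε - 1) * ∑' i : ℕ, ((i + (D + 1) : ℕ) : ℝ) ^ (-1 - ε / 2) := tsum_mul_left
    _ ≤ C * R ^ (ε - 1) * (∑' d : ℕ, (d : ℝ) ^ (-1 - ε / 2) + 1) :=
        mul_le_mul_of_nonneg_left (by linarith) (by positivity)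
    _ = _ := by ring

theorem sqDensity_mul {m n : ℕ} (h : Nat.Coprime m n) :
    sqDensity (m * n) = sqDensity m * sqDensity n := by
  let g : ArithmeticFunction ℝ := ⟨fun e => (e.totient : ℝ) / e ^ 2, by simp⟩
  have hg : g.IsMultiplicative := by
    refine ⟨by simp [g], fun {a b} hab => ?_⟩
    simp only [g, ArithmeticFunction.coe_mk, Nat.totient_mul hab, Nat.cast_mul]
    rw [mul_pow, mul_div_mul_comm]
  have hgz := (hg.mul (ArithmeticFunction.isMultiplicative_zeta.natCast (R := ℝ)))
  have hval : ∀ d, sqDensity d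
      = (g * (ArithmeticFunction.zeta : ArithmeticFunction ℝ)) d / (d : ℝ) ^ 2 := by
    intro d
    rw [ArithmeticFunction.coe_mul_zeta_apply]; rfl
  rw [hval, hval, hval, hgz.map_mul_of_coprime h, Nat.cast_mul, mul_pow, mul_div_mul_comm]

theorem densityTerm_mul {m n : ℕ} (h : Nat.Coprime m n) :
    densityTerm (m * n) = densityTerm m * densityTerm n := by
  rw [densityTerm, densityTerm, densityTerm, sqDensity_mul h,
    ArithmeticFunction.isMultiplicative_moebius.map_mul_of_coprime h]
  push_cast; ring

/-- The Möbius function leaves only the terms at `1` and `p` in each Euler factor. -/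
theorem hasProd_densityTerm :
    HasProd (fun p : Nat.Primes => 1 - (1 + ((p : ℝ) - 1) / (p : ℝ) ^ 2) / (p : ℝ) ^ 2)
      (∑' d, densityTerm d) := by
  have h := EulerProduct.eulerProduct_hasProd (f := densityTerm)
    (by simp [densityTerm, sqDensity]) (fun {m n} h => densityTerm_mul h)
    (by simpa [Real.norm_eq_abs] using summable_abs_densityTerm) (by simp [densityTerm])
  have key : (fun p : Nat.Primes => 1 - (1 + ((p : ℝ) - 1) / (p : ℝ) ^ 2) / (p : ℝ) ^ 2)
      = fun p : Nat.Primes => ∑' e, densityTerm (p ^ e) := ?_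
  · rw [key]; exact h
  funext p
  have hp := p.2
  have h0 : ((p : ℕ) : ℝ) ≠ 0 := by exact_mod_cast hp.ne_zero
  rw [tsum_eq_sum (s := Finset.range 2)]
  · rw [Finset.sum_range_succ, Finset.sum_range_one, pow_zero, pow_one]
    simp only [densityTerm, sqDensity, hp.divisors, ArithmeticFunction.moebius_apply_prime hp,
      Finset.sum_pair hp.one_lt.ne, Nat.totient_prime hp]
    rw [Nat.cast_sub hp.one_lt.le]
    simp
    ring
  · intro e he
    have he : e ≠ 0 ∧ e ≠ 1 := by rw [Finset.mem_range] at he; omega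
    rw [densityTerm, ArithmeticFunction.moebius_apply_prime_pow hp he.1, if_neg he.2]
    simp

/-- Prime by prime, `(1 - p⁻²)⁻² (1 - p⁻² - (p-1) p⁻⁴) = 1 + p / ((p+1)² (p-1))`, and `(1 - p⁻²)⁻¹`
is the Euler factor of `ζ(2)`. -/
theorem constA_eq : constA = (Real.pi ^ 2 / 6) ^ 2 * ∑' d, densityTerm d := by
  let f : ℕ →*₀ ℝ :=
    { toFun := fun n => ((n : ℝ) ^ 2)⁻¹
      map_zero' := by simp
      map_one' := by simp
      map_mul' := fun m n => by push_cast; rw [mul_pow, mul_inv] }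
  have hf : ∀ n, f n = 1 / (n : ℝ) ^ 2 := fun n => (one_div _).symm
  have hs : HasSum f (Real.pi ^ 2 / 6) := by
    have := hasSum_zeta_two
    simp_rw [← hf] at this
    exact this
  have h1 := EulerProduct.eulerProduct_completely_multiplicative_hasProd (f := f)
    (by simp [hf])
  rw [hs.tsum_eq] at h1
  have h2 := (h1.mul h1).mul hasProd_densityTerm
  rw [constA, sq, ← h2.tprod_eq]
  refine tprod_congr fun p => ?_
  have hp : (2 : ℝ) ≤ p := by exact_mod_cast p.2.two_le
  have hp1 : (p : ℝ) - 1 ≠ 0 := by linarith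
  have hp2 : (p : ℝ) ^ 2 - 1 ≠ 0 := by nlinarith
  rw [hf]
  have e : (1 - 1 / (p : ℝ) ^ 2)⁻¹ = (p : ℝ) ^ 2 / ((p : ℝ) ^ 2 - 1) := by
    rw [one_sub_div (by positivity), inv_div]
  rw [e]
  have hp3 : (p : ℝ) ^ 2 - 1 = (p - 1) * (p + 1) := by ring
  rw [hp3]
  field_simp
  ring

/-! ### Sieving to square-free `N` -/

theorem exists_pairCount_le_rpow {ε : ℝ} (hε : 0 < ε) :
    ∃ C : ℝ, 0 < C ∧ ∀ (s : ℕ) (Z X : ℝ) (A N : ℕ), 1 ≤ X → 0 < N → (N : ℝ) ≤ 2 * X →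
      (A : ℝ) ≤ 6 * √X → (pairCount s Z A N : ℝ) ≤ C * X ^ (1 / 2 + ε) := by
  obtain ⟨C, hC, h⟩ := exists_card_divisors_le_rpow hε
  refine ⟨13 * (C * (38 : ℝ) ^ ε), by positivity, fun s Z X A N hX hN hNX hA => ?_⟩
  have hsX : 1 ≤ √X := Real.one_le_sqrt.2 hX
  have hsq : √X ^ 2 = X := Real.sq_sqrt (by linarith)
  -- With `β` outermost, `a` runs over divisors of `N + β² ≤ 2X + 36X`, and there are at most `13√X`
  -- values of `β`.
  have h1 : pairCount s Z A N ≤ ∑ β ∈ Finset.Icc (-(A : ℤ)) A,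
      ((N : ℤ) + β ^ 2).toNat.divisors.card := by
    calc pairCount s Z A N ≤ ∑ a ∈ Finset.Icc 1 A, ((Finset.Icc (-(A : ℤ)) A).filter
          (fun β => (a : ℤ) ∣ (N : ℤ) + β ^ 2)).card := by
          refine Finset.sum_le_sum fun a ha => Finset.card_le_card fun β hβ => ?_
          rw [middles, Finset.mem_filter, Finset.mem_filter, Finset.mem_Icc] at hβ
          rw [Finset.mem_filter, Finset.mem_Icc]
          have := (Finset.mem_Icc.1 ha).2
          exact ⟨by omega, hβ.2⟩
      _ = ∑ β ∈ Finset.Icc (-(A : ℤ)) A, ((Finset.Icc 1 A).filter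
          (fun a : ℕ => (a : ℤ) ∣ (N : ℤ) + β ^ 2)).card := by
          simp_rw [Finset.card_filter]
          rw [Finset.sum_comm]
      _ ≤ _ := by
          refine Finset.sum_le_sum fun β _ => Finset.card_le_card fun a ha => ?_
          have hp : 0 < (N : ℤ) + β ^ 2 := by positivity
          rw [Nat.mem_divisors]
          refine ⟨?_, by omega⟩
          rw [← Int.natCast_dvd_natCast, Int.toNat_of_nonneg hp.le]
          exact (Finset.mem_filter.1 ha).2
  have h2 : ∀ β ∈ Finset.Icc (-(A : ℤ)) A,
      (((N : ℤ) + β ^ 2).toNat.divisors.card : ℝ) ≤ C * ((38 : ℝ) ^ ε * X ^ ε) := by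
    intro β hβ
    have hp : 0 < (N : ℤ) + β ^ 2 := by positivity
    refine (h _ (by omega)).trans ?_
    refine mul_le_mul_of_nonneg_left ?_ (by linarith)
    rw [← Real.mul_rpow (by norm_num) (by linarith)]
    refine Real.rpow_le_rpow (by positivity) ?_ hε.le
    have e : ((((N : ℤ) + β ^ 2).toNat : ℕ) : ℝ) = N + (β : ℝ) ^ 2 := by
      have := Int.toNat_of_nonneg hp.le
      have h3 : ((((N : ℤ) + β ^ 2).toNat : ℤ) : ℝ) = (((N : ℤ) + β ^ 2 : ℤ) : ℝ) := by rw [this]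
      push_cast at h3
      exact_mod_cast h3
    have hβ2 : (β : ℝ) ^ 2 ≤ (A : ℝ) ^ 2 := by
      have := Finset.mem_Icc.1 hβ
      refine sq_le_sq' ?_ ?_
      · exact_mod_cast this.1
      · exact_mod_cast this.2
    have hA2 : (A : ℝ) ^ 2 ≤ (6 * √X) ^ 2 := pow_le_pow_left₀ (by positivity) hA 2
    rw [e]
    nlinarith
  have h1' : (pairCount s Z A N : ℝ) ≤ ∑ β ∈ Finset.Icc (-(A : ℤ)) A,
      (((N : ℤ) + β ^ 2).toNat.divisors.card : ℝ) := by exact_mod_cast h1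
  refine h1'.trans ((Finset.sum_le_sum h2).trans ?_)
  rw [Finset.sum_const, Int.card_Icc, nsmul_eq_mul, Real.rpow_add (by linarith),
    ← Real.sqrt_eq_rpow]
  have hc : (((A : ℤ) + 1 - -(A : ℤ)).toNat : ℝ) ≤ 13 * √X := by
    have : ((A : ℤ) + 1 - -(A : ℤ)).toNat = 2 * A + 1 := by omega
    rw [this]; push_cast; linarith
  calc _ ≤ 13 * √X * (C * ((38 : ℝ) ^ ε * X ^ ε)) :=
        mul_le_mul_of_nonneg_right hc (by positivity)
    _ = _ := by ring

theorem card_filter_dvd_le {X Y : ℝ} (hX : 0 < X) (hY : 0 ≤ Y) {m : ℕ} (hm : 0 < m) :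
    (((natsIn X Y).filter (fun N => m ∣ N)).card : ℝ) ≤ Y / m + 2 := by
  have h := abs_card_modEq_sub_le hX hY hm 0
  have e : (natsIn X Y).filter (fun N => m ∣ N) = (natsIn X Y).filter (fun N => N ≡ 0 [MOD m]) :=
    Finset.filter_congr fun N _ => (Nat.modEq_zero_iff_dvd).symm
  rw [e]
  linarith [(abs_le.1 h).2]

theorem sum_squarefree_eq (f : ℕ → ℝ) {M : ℕ} {S : Finset ℕ} (hS : ∀ N ∈ S, N ≠ 0 ∧ N ≤ M ^ 2) :
    ∑ N ∈ S.filter Squarefree, f N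
      = ∑ d ∈ Finset.Icc 1 M, (ArithmeticFunction.moebius d : ℝ) *
          ∑ N ∈ S.filter (fun N => d ^ 2 ∣ N), f N := by
  simp_rw [Finset.mul_sum, Finset.sum_filter]
  rw [Finset.sum_comm]
  refine Finset.sum_congr rfl fun N hN => ?_
  have h := sum_moebius_sq_dvd (hS N hN).1 (hS N hN).2
  have h' : ∑ d ∈ (Finset.Icc 1 M).filter (fun d => d ^ 2 ∣ N),
      (ArithmeticFunction.moebius d : ℝ) = if Squarefree N then 1 else 0 := by exact_mod_cast h
  rw [← Finset.sum_filter, ← Finset.sum_mul, h']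
  split_ifs <;> simp

theorem local_error_le {ε X Y A : ℝ} (hε : 0 < ε) (hX : 1 ≤ X) (hY : 0 ≤ Y) (hYX : Y ≤ X)
    (hA0 : 0 < A) (hA : A ≤ 6 * √X) :
    Y + 4 * Y * (1 + Real.log A) + 2 * A * (2 * A + 1)
      ≤ (1 + 4 * (3 + 1 / ε) + 156) * (X ^ ε * X) := by
  have hX0 : 0 < X := by linarith
  have hr1 : 1 ≤ √X := Real.one_le_sqrt.2 hX
  have hr2 : √X ^ 2 = X := Real.sq_sqrt hX0.le
  have hXε : 1 ≤ X ^ ε := Real.one_le_rpow hX hε.le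
  have hrX : √X ≤ X := by nlinarith
  have hlog6 : Real.log 6 ≤ 2 := by
    rw [Real.log_le_iff_le_exp (by norm_num)]
    have := Real.exp_one_gt_d9
    rw [show (2 : ℝ) = 1 + 1 by norm_num, Real.exp_add]
    nlinarith
  have hlog : Real.log A ≤ 2 + 1 / ε * X ^ ε := by
    calc Real.log A ≤ Real.log (6 * √X) := Real.log_le_log hA0 hA
      _ = Real.log 6 + Real.log √X := Real.log_mul (by norm_num) (by positivity)
      _ ≤ 2 + Real.log X := add_le_add hlog6 (Real.log_le_log (by linarith) hrX)
      _ ≤ _ := by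
          have := Real.log_le_rpow_div hX0.le hε
          rw [div_eq_inv_mul, ← one_div] at this
          linarith
  have h1 : 1 + Real.log A ≤ (3 + 1 / ε) * X ^ ε := by
    rw [add_mul]; linarith
  have h2 : 4 * Y * (1 + Real.log A) ≤ 4 * (3 + 1 / ε) * (X ^ ε * X) := by
    calc _ ≤ 4 * Y * ((3 + 1 / ε) * X ^ ε) := mul_le_mul_of_nonneg_left h1 (by linarith)
      _ ≤ 4 * X * ((3 + 1 / ε) * X ^ ε) :=
          mul_le_mul_of_nonneg_right (by linarith) (by positivity)
      _ = _ := by ring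
  have h4 : X ≤ X ^ ε * X := le_mul_of_one_le_left hX0.le hXε
  have h3 : 2 * A * (2 * A + 1) ≤ 156 * X := by
    calc 2 * A * (2 * A + 1) ≤ 2 * (6 * √X) * (13 * √X) := by
          refine mul_le_mul (by linarith) (by linarith) (by linarith) (by positivity)
      _ = 156 * √X ^ 2 := by ring
      _ = _ := by rw [hr2]
  linarith

set_option maxHeartbeats 1000000 in
/-- The asymptotic count of reduced forms `a x² + 2 b x y + c y²` with `a c - b²` square-free in
`[X, X + Y]`. -/
theorem exists_abs_sum_squarefree_pairCount_sub_le {ε : ℝ} (hε : 0 < ε) (hε1 : ε ≤ 1) :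
    ∃ C : ℝ, 0 < C ∧ ∀ (s : ℕ) (X Y σ : ℝ), s ≤ 1 → 1 ≤ Y → Y ≤ X → 0 < σ → σ ^ 2 ≤ X + Y →
      |∑ N ∈ (natsIn X Y).filter Squarefree, (pairCount s (σ ^ 2) ⌈2 * σ⌉₊ N : ℝ)
        - Real.pi / 3 * Y * σ * ∑' d, densityTerm d|
        ≤ C * (X ^ ε * (X * (X ^ (1 / 12 : ℝ) * Y ^ (1 / 6 : ℝ)))) := by
  obtain ⟨C₁, hC₁, h₁⟩ := exists_pairCount_le_rpow hε
  obtain ⟨C₂, hC₂, h₂⟩ := exists_abs_sum_densityTerm_sub_tsum_le hε hε1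
  refine ⟨(1 + 4 * (3 + 1 / ε) + 156) + 8 * C₁ + 4 * C₂, by positivity,
    fun s X Y σ hs hY hYX hσ hσX => ?_⟩
  have hX : 1 ≤ X := hY.trans hYX
  have hX0 : 0 < X := by linarith
  have hY0 : 0 < Y := by linarith
  have hr1 : 1 ≤ √X := Real.one_le_sqrt.2 hX
  have hr2 : √X ^ 2 = X := Real.sq_sqrt hX0.le
  set r := √X with hr
  have hσr : σ ≤ 2 * r := abs_le_of_sq_le_sq' (by nlinarith) (by linarith) |>.2
  have hXε : 1 ≤ X ^ ε := Real.one_le_rpow hX hε.le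
  -- The cut between small and large `d`, chosen so that `X R / (X Y)` is the error term aimed at.
  -- As `Y ≤ √X R²`, the quantity `Y √X / R` from large `d` is at most `X R`.
  set R : ℝ := X ^ (1 / 12 : ℝ) * Y ^ (1 / 6 : ℝ) with hR
  have hR1 : 1 ≤ R := one_le_mul_of_one_le_of_one_le (Real.one_le_rpow hX (by norm_num))
    (Real.one_le_rpow hY (by norm_num))
  have hRr : R ≤ r := by
    calc R ≤ X ^ (1 / 12 : ℝ) * X ^ (1 / 6 : ℝ) :=
          mul_le_mul_of_nonneg_left (Real.rpow_le_rpow hY0.le hYX (by norm_num)) (by positivity)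
      _ = X ^ (1 / 4 : ℝ) := by rw [← Real.rpow_add hX0]; norm_num
      _ ≤ X ^ (1 / 2 : ℝ) := Real.rpow_le_rpow_of_exponent_le hX (by norm_num)
      _ = r := by rw [hr, Real.sqrt_eq_rpow]
  have hYR : Y ≤ r * R ^ 2 := by
    have e : r * R ^ 2 = X ^ (2 / 3 : ℝ) * Y ^ (1 / 3 : ℝ) := by
      rw [hR, hr, Real.sqrt_eq_rpow, mul_pow, ← Real.rpow_natCast, ← Real.rpow_natCast,
        ← Real.rpow_mul hX0.le, ← Real.rpow_mul hY0.le, ← mul_assoc, ← Real.rpow_add hX0]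
      norm_num
    rw [e]
    calc Y = Y ^ (2 / 3 : ℝ) * Y ^ (1 / 3 : ℝ) := by rw [← Real.rpow_add hY0]; norm_num
      _ ≤ _ := mul_le_mul_of_nonneg_right (Real.rpow_le_rpow hY0.le hYX (by norm_num))
          (by positivity)
  have hYrR : Y * r / R ≤ X * R := by
    rw [div_le_iff₀ (by linarith), ← hr2]
    nlinarith
  set A := ⌈2 * σ⌉₊ with hA
  have hAσ : 2 * σ ≤ A := Nat.le_ceil _
  have hA6 : (A : ℝ) ≤ 6 * r := by
    have := Nat.ceil_lt_add_one (show 0 ≤ 2 * σ by positivity)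
    linarith
  have hA0 : (0 : ℝ) < A := by linarith
  set M := ⌈2 * r⌉₊ with hM
  have hM1 : 2 * r ≤ M := Nat.le_ceil _
  have hM2 : (M : ℝ) ≤ 3 * r := by
    have := Nat.ceil_lt_add_one (show 0 ≤ 2 * r by positivity)
    linarith
  set D := ⌊R⌋₊ with hD
  have hD1 : (D : ℝ) ≤ R := Nat.floor_le (by linarith)
  have hD2 : R ≤ D + 1 := (Nat.lt_floor_add_one R).le
  have hDM : D ≤ M := by
    have : (D : ℝ) ≤ M := by linarith
    exact_mod_cast this
  have hmem : ∀ N ∈ natsIn X Y, 0 < N ∧ (N : ℝ) ≤ 2 * X := by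
    intro N hN
    obtain ⟨h1, h2⟩ := (mem_natsIn hX0 hY0.le).1 hN
    refine ⟨?_, by linarith⟩
    have : (0 : ℝ) < N := by linarith
    exact_mod_cast this
  set S : ℕ → ℝ := fun N => (pairCount s (σ ^ 2) A N : ℝ) with hS
  set c : ℕ → ℝ := fun d => ∑ N ∈ (natsIn X Y).filter (fun N => d ^ 2 ∣ N), S N with hc
  have hsplit : ∑ N ∈ (natsIn X Y).filter Squarefree, S N
      = ∑ d ∈ Finset.Icc 1 D, (ArithmeticFunction.moebius d : ℝ) * c d
        + ∑ d ∈ Finset.Ioo D (M + 1), (ArithmeticFunction.moebius d : ℝ) * c d := by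
    rw [sum_squarefree_eq S (M := M), ← Finset.sum_union]
    · congr 1
      ext d
      simp only [Finset.mem_union, Finset.mem_Icc, Finset.mem_Ioo]
      omega
    · rw [Finset.disjoint_left]
      intro d h1 h2
      rw [Finset.mem_Icc] at h1
      rw [Finset.mem_Ioo] at h2
      omega
    · intro N hN
      obtain ⟨h1, h2⟩ := hmem N hN
      refine ⟨h1.ne', ?_⟩
      have : (N : ℝ) ≤ (M : ℝ) ^ 2 := by nlinarith
      exact_mod_cast this
  have hμ : ∀ d, |(ArithmeticFunction.moebius d : ℝ)| ≤ 1 := fun d => by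
    exact_mod_cast ArithmeticFunction.abs_moebius_le_one
  set E : ℝ := Y + 4 * Y * (1 + Real.log A) + 2 * A * (2 * A + 1) with hE
  have hE0 : E ≤ (1 + 4 * (3 + 1 / ε) + 156) * (X ^ ε * X) :=
    local_error_le hε hX hY0.le hYX hA0 hA6
  have hpart1 : |∑ d ∈ Finset.Icc 1 D, (ArithmeticFunction.moebius d : ℝ) * c d
      - Real.pi / 3 * Y * σ * ∑ d ∈ Finset.Icc 1 D, densityTerm d| ≤ R * E := by
    have hEnn : 0 ≤ E := by
      have := Real.log_natCast_nonneg A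
      positivity
    rw [Finset.mul_sum, ← Finset.sum_sub_distrib]
    refine (Finset.abs_sum_le_sum_abs _ _).trans ?_
    calc _ ≤ ∑ d ∈ Finset.Icc 1 D, E := by
          refine Finset.sum_le_sum fun d _ => ?_
          rw [densityTerm, show (ArithmeticFunction.moebius d : ℝ) * c d
            - Real.pi / 3 * Y * σ * ((ArithmeticFunction.moebius d : ℝ) * sqDensity d)
            = (ArithmeticFunction.moebius d : ℝ) * (c d - Real.pi / 3 * Y * σ * sqDensity d) by
              ring]
          by_cases hd : Squarefree d
          · rw [abs_mul]
            have := abs_sum_pairCount_sub_le hs hX0 hY0.le hσ hAσ hd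
            rw [Nat.cast_sum] at this
            exact (mul_le_of_le_one_left (abs_nonneg _) (hμ d)).trans this
          · rw [ArithmeticFunction.moebius_eq_zero_of_not_squarefree hd]
            simpa using hEnn
      _ = D * E := by rw [Finset.sum_const, Nat.card_Icc, nsmul_eq_mul]; simp
      _ ≤ R * E := mul_le_mul_of_nonneg_right hD1 hEnn
  -- At most `Y/d² + 2` integers are multiples of `d²`, each contributing `O(X^(1/2+ε))`; summation
  -- over `R < d ≤ M` leaves `Y/R + √X`.
  have hpart2 : |∑ d ∈ Finset.Ioo D (M + 1), (ArithmeticFunction.moebius d : ℝ) * c d|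
      ≤ 8 * C₁ * (X ^ ε * (X * R)) := by
    have hB : ∀ d ∈ Finset.Ioo D (M + 1), |(ArithmeticFunction.moebius d : ℝ) * c d|
        ≤ C₁ * X ^ (1 / 2 + ε) * (Y * ((d : ℝ) ^ 2)⁻¹ + 2) := by
      intro d hd
      have hd0 : 0 < d := by rw [Finset.mem_Ioo] at hd; omega
      have hc0 : 0 ≤ c d := Finset.sum_nonneg fun _ _ => Nat.cast_nonneg _
      rw [abs_mul, abs_of_nonneg hc0]
      refine (mul_le_of_le_one_left hc0 (hμ d)).trans ?_
      calc c d ≤ ∑ N ∈ (natsIn X Y).filter (fun N => d ^ 2 ∣ N), C₁ * X ^ (1 / 2 + ε) := by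
            refine Finset.sum_le_sum fun N hN => ?_
            obtain ⟨h1, h2⟩ := hmem N (Finset.mem_filter.1 hN).1
            exact h₁ s _ X A N hX h1 h2 hA6
        _ = C₁ * X ^ (1 / 2 + ε) * (((natsIn X Y).filter (fun N => d ^ 2 ∣ N)).card : ℝ) := by
            rw [Finset.sum_const, nsmul_eq_mul, mul_comm]
        _ ≤ _ := by
            refine mul_le_mul_of_nonneg_left ?_ (by positivity)
            have := card_filter_dvd_le hX0 hY0.le (m := d ^ 2) (by positivity)
            push_cast at this
            rwa [div_eq_mul_inv] at this
    refine (Finset.abs_sum_le_sum_abs _ _).trans ((Finset.sum_le_sum hB).trans ?_)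
    rw [← Finset.mul_sum, Finset.sum_add_distrib, ← Finset.mul_sum, Finset.sum_const,
      Nat.card_Ioo, nsmul_eq_mul]
    have h1 : ∑ d ∈ Finset.Ioo D (M + 1), ((d : ℝ) ^ 2)⁻¹ ≤ 2 / R :=
      (sum_Ioo_inv_sq_le D (M + 1)).trans
        (div_le_div_of_nonneg_left (by norm_num) (by linarith) hD2)
    have h2 : ((M + 1 - D - 1 : ℕ) : ℝ) ≤ M := by
      have : M + 1 - D - 1 ≤ M := by omega
      exact_mod_cast this
    have h3 : Y * ∑ d ∈ Finset.Ioo D (M + 1), ((d : ℝ) ^ 2)⁻¹ ≤ 2 * (Y / R) := by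
      calc _ ≤ Y * (2 / R) := mul_le_mul_of_nonneg_left h1 hY0.le
        _ = _ := by ring
    have h4 : X ^ (1 / 2 + ε) = r * X ^ ε := by
      rw [Real.rpow_add hX0, hr, Real.sqrt_eq_rpow]
    rw [h4]
    have h5 : r * (2 * (Y / R) + 6 * r) ≤ 8 * (X * R) := by
      have : X ≤ X * R := le_mul_of_one_le_right hX0.le hR1
      have e : r * (2 * (Y / R) + 6 * r) = 2 * (Y * r / R) + 6 * r ^ 2 := by ring
      rw [e, hr2]; linarith
    calc _ ≤ C₁ * (r * X ^ ε) * (2 * (Y / R) + 6 * r) :=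
          mul_le_mul_of_nonneg_left (by linarith) (by positivity)
      _ = C₁ * X ^ ε * (r * (2 * (Y / R) + 6 * r)) := by ring
      _ ≤ C₁ * X ^ ε * (8 * (X * R)) := mul_le_mul_of_nonneg_left h5 (by positivity)
      _ = _ := by ring
  have hpart3 : |Real.pi / 3 * Y * σ * ∑ d ∈ Finset.Icc 1 D, densityTerm d
      - Real.pi / 3 * Y * σ * ∑' d, densityTerm d| ≤ 4 * C₂ * (X ^ ε * (X * R)) := by
    rw [← mul_sub, abs_mul, abs_of_nonneg (by positivity)]
    have h1 := h₂ D R hR1 hD2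
    have h2 : R ^ (ε - 1) ≤ X ^ ε / R := by
      rw [Real.rpow_sub (by linarith), Real.rpow_one]
      refine div_le_div_of_nonneg_right (Real.rpow_le_rpow (by linarith) ?_ hε.le) (by linarith)
      nlinarith
    have h3 : Real.pi / 3 * Y * σ ≤ 4 * (Y * r) := by
      have hpi : Real.pi / 3 ≤ 2 := by linarith [Real.pi_le_four]
      calc _ = Real.pi / 3 * (Y * σ) := by ring
        _ ≤ 2 * (Y * (2 * r)) := by gcongr
        _ = _ := by ring
    calc _ ≤ 4 * (Y * r) * (C₂ * (X ^ ε / R)) := by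
          refine mul_le_mul h3 (h1.trans (mul_le_mul_of_nonneg_left h2 hC₂.le)) (abs_nonneg _)
            (by positivity)
      _ = 4 * C₂ * (X ^ ε * (Y * r / R)) := by ring
      _ ≤ _ := by gcongr
  have hRE : R * E ≤ (1 + 4 * (3 + 1 / ε) + 156) * (X ^ ε * (X * R)) := by
    calc R * E ≤ R * ((1 + 4 * (3 + 1 / ε) + 156) * (X ^ ε * X)) :=
          mul_le_mul_of_nonneg_left hE0 (by linarith)
      _ = _ := by ring
  rw [hsplit]
  rw [abs_le] at hpart1 hpart2 hpart3 ⊢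
  constructor <;> linarith

/-! ### Reduced forms against pairs -/

theorem reducedEven_ncard_le_pairCount {N A : ℕ} {Z : ℝ} (hNZ : (N : ℝ) ≤ Z)
    (hA : 2 * √Z ≤ A) : (BinForm.reducedEven N).ncard ≤ pairCount 0 Z A N := by
  rw [pairCount, ← Finset.card_sigma, ← Set.ncard_coe_finset]
  have hZ : 0 ≤ Z := (Nat.cast_nonneg _).trans hNZ
  refine Set.ncard_le_ncard_of_injOn (fun f => ⟨f.a.toNat, f.b⟩) ?_ ?_ (Finset.finite_toSet _)
  · rintro f ⟨h1, h2, h3, h4⟩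
    have ha : ((f.a.toNat : ℕ) : ℤ) = f.a := Int.toNat_of_nonneg h2.le
    have haR : ((f.a.toNat : ℕ) : ℝ) = (f.a : ℝ) := by
      rw [← Int.cast_natCast, ha]
    -- This is `a ≤ c` rewritten through `ac = N + β²`; together with `2|β| ≤ a` it bounds `a` by
    -- `2√(N/3)`.
    have h5 : f.a ^ 2 - f.b ^ 2 ≤ N := by nlinarith
    have h0 := abs_nonneg f.b
    have h6 : 4 * f.b ^ 2 ≤ f.a ^ 2 := by rw [← sq_abs f.b]; nlinarith
    have h7 : 3 * f.a ^ 2 ≤ 4 * N := by linarith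
    have h7R : 3 * (f.a : ℝ) ^ 2 ≤ 4 * N := by exact_mod_cast h7
    have h5R : (f.a : ℝ) ^ 2 - (f.b : ℝ) ^ 2 ≤ N := by exact_mod_cast h5
    have h8 : (f.a : ℝ) ≤ A := by
      refine le_trans ?_ hA
      have := Real.sq_sqrt hZ
      exact abs_le_of_sq_le_sq' (by nlinarith) (by positivity) |>.2
    have h9 : f.a ≤ A := by exact_mod_cast h8
    simp only [Finset.coe_sigma, Set.mem_sigma_iff, Finset.mem_coe, Finset.mem_Icc,
      Finset.mem_filter, middles, ha, haR]
    refine ⟨⟨by omega, by omega⟩, ⟨⟨?_, ?_⟩, ?_, ?_⟩, ?_⟩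
    · have := neg_abs_le f.b; omega
    · have := le_abs_self f.b; omega
    · push_cast; omega
    · linarith
    · exact ⟨f.c, by linear_combination -h1⟩
  · rintro f ⟨h1, h2, -⟩ g ⟨h1', h2', -⟩ h
    simp only [Sigma.mk.injEq, heq_eq_eq] at h
    have ha : f.a = g.a := by omega
    refine BinForm.ext ha h.2 ?_
    rw [← ha, ← h.2] at h1'
    exact mul_left_cancel₀ h2.ne' (by linear_combination h1 - h1')

/-- The shift `s = 1` makes `2|β| < a`, and `Z < N` makes `a < c`. -/
theorem pairCount_le_strictlyReducedEven_ncard {N A : ℕ} {Z : ℝ} (hNZ : Z < N) :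
    pairCount 1 Z A N ≤ (BinForm.strictlyReducedEven N).ncard := by
  rw [pairCount, ← Finset.card_sigma, ← Set.ncard_coe_finset]
  have hfin : (BinForm.strictlyReducedEven N).Finite :=
    (BinForm.reducedEven_finite N).subset fun f hf => by
      have := abs_nonneg f.b
      exact ⟨hf.1, by have := hf.2.1; omega, hf.2.1.le, hf.2.2.le⟩
  refine Set.ncard_le_ncard_of_injOn
    (fun x : Σ _ : ℕ, ℤ => (⟨x.1, x.2, ((N : ℤ) + x.2 ^ 2) / x.1⟩ : BinForm)) ?_ ?_ hfin
  · rintro ⟨a, β⟩ h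
    simp only [Finset.coe_sigma, Set.mem_sigma_iff, Finset.mem_coe, Finset.mem_Icc,
      Finset.mem_filter, middles] at h
    obtain ⟨⟨ha, -⟩, ⟨-, h2, h3⟩, c, hc⟩ := h
    have ha0 : (a : ℤ) ≠ 0 := by omega
    have hdiv : ((N : ℤ) + β ^ 2) / a = c := by rw [hc]; exact Int.mul_ediv_cancel_left _ ha0
    refine ⟨?_, ?_, ?_⟩ <;> simp only [hdiv]
    · linear_combination -hc
    · push_cast at h2; omega
    · have h4 : (a : ℝ) ^ 2 < N + (β : ℝ) ^ 2 := by linarith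
      have h5 : (a : ℤ) ^ 2 < N + β ^ 2 := by exact_mod_cast h4
      rw [hc, sq] at h5
      exact lt_of_mul_lt_mul_left h5 (by omega)
  · rintro ⟨a, β⟩ - ⟨a', β'⟩ - h
    simp only [BinForm.mk.injEq, Nat.cast_inj] at h
    obtain ⟨rfl, rfl, -⟩ := h
    rfl

/-! ### Summing over the levels -/

theorem exists_abs_sum_levelSum_sub_le {ε : ℝ} (hε : 0 < ε) (hε1 : ε ≤ 1) :
    ∃ C : ℝ, 0 < C ∧ ∀ (P : ℕ) (X Y : ℝ), P.Prime → P ≠ 2 → 2 ≤ X → 1 ≤ Y → Y ≤ X →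
      |∑ N ∈ levels P X Y, levelSum P N - P / 2 * (Real.pi / 3 * Y * √X * ∑' d, densityTerm d)|
        ≤ C * (Y * √X + P * (X ^ ε * (X * (X ^ (1 / 12 : ℝ) * Y ^ (1 / 6 : ℝ))))
          + P * (Y ^ 2 / √X) + (Y + P) * (√X * X ^ ε)) := by
  obtain ⟨C₁, hC₁, h₁⟩ := exists_abs_sum_squarefree_pairCount_sub_le hε hε1
  obtain ⟨C₂, hC₂, h₂⟩ := exists_pairCount_le_rpow hε
  set κ := ∑' d, densityTerm d with hκ
  set K : ℝ := Real.pi / 3 * |κ| with hK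
  have hK0 : 0 ≤ K := by positivity
  refine ⟨K + C₁ + C₂, by positivity, fun P X Y hP hP2 hX hY hYX => ?_⟩
  have hX0 : 0 < X := by linarith
  have hY0 : 0 < Y := by linarith
  have hr1 : 1 ≤ √X := Real.one_le_sqrt.2 (by linarith)
  have hr2 : √X ^ 2 = X := Real.sq_sqrt hX0.le
  set r := √X with hr
  set Q : ℝ := X ^ ε * (X * (X ^ (1 / 12 : ℝ) * Y ^ (1 / 6 : ℝ))) with hQ
  have hQ0 : 0 ≤ Q := by positivity
  have hP3 : (3 : ℝ) ≤ P := by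
    have := hP.two_le
    have : 3 ≤ P := by omega
    exact_mod_cast this
  have hlev : levels P X Y = ((natsIn X Y).filter Squarefree).filter (fun N => ¬ P ∣ N) := by
    ext N
    simp only [levels, natsIn, Finset.mem_filter, and_assoc]
  -- Moving the radius from `√X` to `σ` costs `O(Y²/√X)`, the source of the term `PY / X^(3/2)`.
  have hdiff : ∀ σ : ℝ, |σ - r| ≤ Y / r →
      |Real.pi / 3 * Y * σ * κ - Real.pi / 3 * Y * r * κ| ≤ K * (Y ^ 2 / r) := by
    intro σ hσ
    have e : Real.pi / 3 * Y * σ * κ - Real.pi / 3 * Y * r * κ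
        = (Real.pi / 3 * κ) * (Y * (σ - r)) := by ring
    rw [e, abs_mul, abs_mul, abs_mul, abs_of_nonneg (by positivity : 0 ≤ Real.pi / 3),
      abs_of_pos hY0]
    calc _ ≤ Real.pi / 3 * |κ| * (Y * (Y / r)) := by gcongr
      _ = _ := by ring
  set G : ℝ := Real.pi / 3 * Y * r * κ with hG
  have hGabs : |G| ≤ K * (Y * r) := by
    rw [hG, abs_mul, abs_of_nonneg (by positivity), hK]
    exact le_of_eq (by ring)
  -- the upper bound
  have hupper : ∑ N ∈ levels P X Y, levelSum P N
      ≤ (P + 2) / 2 * (G + K * (Y ^ 2 / r) + C₁ * Q) := by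
    set σ := √(X + Y) with hσd
    have hσ2 : σ ^ 2 = X + Y := Real.sq_sqrt (by positivity)
    have hσ0 : 0 < σ := Real.sqrt_pos.2 (by positivity)
    have h := (abs_le.1 (h₁ 0 X Y σ (by norm_num) hY hYX hσ0 hσ2.le)).2
    have hσr : |σ - r| ≤ Y / r := by
      have h0 : r ≤ σ := Real.sqrt_le_sqrt (by linarith)
      rw [abs_of_nonneg (by linarith), le_div_iff₀ (by linarith)]
      nlinarith
    have hd := (abs_le.1 (hdiff σ hσr)).2
    calc ∑ N ∈ levels P X Y, levelSum P N
        ≤ ∑ N ∈ levels P X Y, ((P : ℝ) + 2) / 2 * (pairCount 0 (σ ^ 2) ⌈2 * σ⌉₊ N : ℝ) := by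
          refine Finset.sum_le_sum fun N hN => ?_
          rw [hlev, Finset.mem_filter, Finset.mem_filter, mem_natsIn hX0 hY0.le] at hN
          obtain ⟨⟨⟨-, hN2⟩, hN3⟩, -⟩ := hN
          refine (levelSum_le hP hP2 (Nat.pos_of_ne_zero hN3.ne_zero)).trans ?_
          refine mul_le_mul_of_nonneg_left ?_ (by positivity)
          have := reducedEven_ncard_le_pairCount (N := N) (A := ⌈2 * σ⌉₊) (Z := σ ^ 2)
            (by rw [hσ2]; exact hN2) (by rw [Real.sqrt_sq hσ0.le]; exact Nat.le_ceil _)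
          exact_mod_cast this
      _ = ((P : ℝ) + 2) / 2 * ∑ N ∈ levels P X Y, (pairCount 0 (σ ^ 2) ⌈2 * σ⌉₊ N : ℝ) := by
          rw [Finset.mul_sum]
      _ ≤ ((P : ℝ) + 2) / 2 * ∑ N ∈ (natsIn X Y).filter Squarefree,
            (pairCount 0 (σ ^ 2) ⌈2 * σ⌉₊ N : ℝ) := by
          refine mul_le_mul_of_nonneg_left ?_ (by positivity)
          rw [hlev]
          exact Finset.sum_le_sum_of_subset_of_nonneg (Finset.filter_subset _ _)
            fun _ _ _ => Nat.cast_nonneg _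
      _ ≤ _ := mul_le_mul_of_nonneg_left (by linarith) (by positivity)
  -- the lower bound
  have hlower : (P - 2) / 2 * (G - K * (Y ^ 2 / r) - C₁ * Q - (Y / P + 2) * (C₂ * (r * X ^ ε)))
      ≤ ∑ N ∈ levels P X Y, levelSum P N := by
    -- Every `N` in the interval exceeds `X - 1` strictly, as strictly reduced forms require.
    set σ := √(X - 1) with hσd
    have hσ2 : σ ^ 2 = X - 1 := Real.sq_sqrt (by linarith)
    have hσ0 : 0 < σ := Real.sqrt_pos.2 (by linarith)
    have h := (abs_le.1 (h₁ 1 X Y σ le_rfl hY hYX hσ0 (by rw [hσ2]; linarith))).1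
    have hσr0 : σ ≤ r := Real.sqrt_le_sqrt (by linarith)
    have hσr : |σ - r| ≤ Y / r := by
      rw [abs_of_nonpos (by linarith), le_div_iff₀ (by linarith)]
      nlinarith
    have hd := (abs_le.1 (hdiff σ hσr)).1
    set A := ⌈2 * σ⌉₊ with hA
    have hA6 : (A : ℝ) ≤ 6 * √X := by
      have := Nat.ceil_lt_add_one (show 0 ≤ 2 * σ by positivity)
      rw [← hr]
      linarith
    have hP20 : (0 : ℝ) ≤ (P - 2) / 2 := by linarith
    set S : ℕ → ℝ := fun N => (pairCount 1 (σ ^ 2) A N : ℝ) with hS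
    -- The sieve also counts `N` divisible by `P`, which are not levels; the divisor bound removes
    -- them.
    have hbad : ∑ N ∈ ((natsIn X Y).filter Squarefree).filter (fun N => P ∣ N), S N
        ≤ (Y / P + 2) * (C₂ * (r * X ^ ε)) := by
      have h4 : X ^ (1 / 2 + ε) = r * X ^ ε := by
        rw [Real.rpow_add hX0, hr, Real.sqrt_eq_rpow]
      calc _ ≤ ∑ N ∈ (natsIn X Y).filter (fun N => P ∣ N), S N := by
            refine Finset.sum_le_sum_of_subset_of_nonneg ?_ fun _ _ _ => Nat.cast_nonneg _
            exact Finset.filter_subset_filter _ (Finset.filter_subset _ _)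
        _ ≤ ∑ N ∈ (natsIn X Y).filter (fun N => P ∣ N), C₂ * (r * X ^ ε) := by
            refine Finset.sum_le_sum fun N hN => ?_
            rw [Finset.mem_filter, mem_natsIn hX0 hY0.le] at hN
            rw [← h4]
            refine h₂ 1 _ X A N (by linarith) ?_ (by linarith [hN.1.2]) hA6
            have : (0 : ℝ) < N := by linarith [hN.1.1]
            exact_mod_cast this
        _ = (((natsIn X Y).filter (fun N => P ∣ N)).card : ℝ) * (C₂ * (r * X ^ ε)) := by
            rw [Finset.sum_const, nsmul_eq_mul]
        _ ≤ _ := mul_le_mul_of_nonneg_right (card_filter_dvd_le hX0 hY0.le hP.pos)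
            (by positivity)
    have hsplit := Finset.sum_filter_add_sum_filter_not ((natsIn X Y).filter Squarefree)
      (fun N => P ∣ N) S
    calc _ ≤ ((P : ℝ) - 2) / 2 * ∑ N ∈ levels P X Y, S N := by
          refine mul_le_mul_of_nonneg_left ?_ hP20
          rw [hlev]
          linarith
      _ = ∑ N ∈ levels P X Y, ((P : ℝ) - 2) / 2 * S N := by rw [Finset.mul_sum]
      _ ≤ _ := by
          refine Finset.sum_le_sum fun N hN => ?_
          rw [hlev, Finset.mem_filter, Finset.mem_filter, mem_natsIn hX0 hY0.le] at hN
          obtain ⟨⟨⟨hN1, -⟩, hN3⟩, hN4⟩ := hN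
          refine le_trans (mul_le_mul_of_nonneg_left ?_ hP20) (le_levelSum hP hP2 hN3 hN4)
          have := pairCount_le_strictlyReducedEven_ncard (N := N) (A := A) (Z := σ ^ 2)
            (by rw [hσ2]; linarith)
          exact Nat.cast_le.2 this
  set E : ℝ := K * (Y ^ 2 / r) + C₁ * Q with hE
  have hE0 : 0 ≤ E := by positivity
  set F : ℝ := C₂ * (r * X ^ ε) with hF
  have hF0 : 0 ≤ F := by positivity
  have hPE : ((P : ℝ) + 2) / 2 * E ≤ P * E := mul_le_mul_of_nonneg_right (by linarith) hE0
  have hPE' : ((P : ℝ) - 2) / 2 * E ≤ P * E := mul_le_mul_of_nonneg_right (by linarith) hE0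
  have hPF : ((P : ℝ) - 2) / 2 * ((Y / P + 2) * F) ≤ (Y + P) * F := by
    have h1 : ((P : ℝ) - 2) / 2 * (Y / P + 2) ≤ Y + P := by
      calc ((P : ℝ) - 2) / 2 * (Y / P + 2) ≤ (P : ℝ) / 2 * (Y / P + 2) :=
            mul_le_mul_of_nonneg_right (by linarith) (by positivity)
        _ = Y / 2 + P := by field_simp
        _ ≤ _ := by linarith
    calc _ = ((P : ℝ) - 2) / 2 * (Y / P + 2) * F := by ring
      _ ≤ _ := mul_le_mul_of_nonneg_right h1 hF0
  rw [abs_le] at hGabs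
  have hfin : K * (Y * r) + P * E + (Y + P) * F ≤ (K + C₁ + C₂) * (Y * r + P * Q
      + P * (Y ^ 2 / r) + (Y + P) * (r * X ^ ε)) := by
    have a1 : 0 ≤ Y * r := by positivity
    have a2 : 0 ≤ P * Q := by positivity
    have a3 : 0 ≤ P * (Y ^ 2 / r) := by positivity
    have a4 : 0 ≤ (Y + P) * (r * X ^ ε) := by positivity
    have e : K * (Y * r) + P * E + (Y + P) * F = K * (Y * r) + C₁ * (P * Q)
        + K * (P * (Y ^ 2 / r)) + C₂ * ((Y + P) * (r * X ^ ε)) := by rw [hE, hF]; ring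
    rw [e]
    generalize Y * r = b1 at *
    generalize P * Q = b2 at *
    generalize P * (Y ^ 2 / r) = b3 at *
    generalize (Y + P) * (r * X ^ ε) = b4 at *
    have : (K + C₁ + C₂) * (b1 + b2 + b3 + b4) = K * b1 + C₁ * b2 + K * b3 + C₂ * b4
      + (K * b2 + K * b4 + C₁ * (b1 + b3 + b4) + C₂ * (b1 + b2 + b3)) := by ring
    rw [this]
    have : 0 ≤ K * b2 + K * b4 + C₁ * (b1 + b3 + b4) + C₂ * (b1 + b2 + b3) := by positivity
    linarith
  refine le_trans ?_ hfin
  have hFE : 0 ≤ (Y + P) * F := by positivity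
  rw [abs_le]
  constructor
  -- The discrepancy between `(P - 2)/2` and `P/2` costs `G = O(Y√X)`, which normalises to `1/√X`.
  · have e : ((P : ℝ) - 2) / 2 * (G - K * (Y ^ 2 / r) - C₁ * Q - (Y / P + 2) * F)
        = P / 2 * G - G - (P - 2) / 2 * E - (P - 2) / 2 * ((Y / P + 2) * F) := by rw [hE]; ring
    rw [e] at hlower
    linarith
  · have e : ((P : ℝ) + 2) / 2 * (G + K * (Y ^ 2 / r) + C₁ * Q)
        = P / 2 * G + G + (P + 2) / 2 * E := by rw [hE]; ring
    rw [e] at hupper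
    linarith

/-! ### Normalisation and conclusion -/

theorem exists_abs_classNumberAverage_sub_le {ε : ℝ} (hε : 0 < ε) :
    ∃ C : ℝ, 0 < C ∧ ∀ (P : ℕ) (X Y : ℝ), P.Prime → P ≠ 2 → 2 ≤ X → 1 ≤ Y → Y ≤ X →
      |classNumberAverage P X Y - constA * P / √X|
        ≤ C * ((1 / √X + (P : ℝ) ^ (7 / 6 : ℝ) * X ^ (1 / 12 : ℝ) / Y ^ (5 / 6 : ℝ)
            + P * Y / X ^ (3 / 2 : ℝ)) * (P * X * Y) ^ ε) := by
  -- Capping the exponent at `1` is harmless, since `X ≥ 1`.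
  obtain ⟨C, hC, h⟩ := exists_abs_sum_levelSum_sub_le (ε := min ε 1) (by positivity)
    (min_le_right _ _)
  refine ⟨Real.pi ^ 3 / 6 * C * 2, by positivity, fun P X Y hP hP2 hX hY hYX => ?_⟩
  have hX0 : 0 < X := by linarith
  have hX1 : 1 ≤ X := by linarith
  have hY0 : 0 < Y := by linarith
  have hr1 : 1 ≤ √X := Real.one_le_sqrt.2 hX1
  have hr2 : √X ^ 2 = X := Real.sq_sqrt hX0.le
  have hP1 : (1 : ℝ) ≤ P := by exact_mod_cast hP.one_lt.le
  have hS := h P X Y hP hP2 hX hY hYX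
  have hz : (riemannZeta 2).re = Real.pi ^ 2 / 6 := by
    have e : (Real.pi : ℂ) ^ 2 / 6 = ((Real.pi ^ 2 / 6 : ℝ) : ℂ) := by push_cast; rfl
    rw [riemannZeta_two, e, Complex.ofReal_re]
  have hX32 : X ^ (3 / 2 : ℝ) = X * √X := by
    rw [show (3 / 2 : ℝ) = 1 + 1 / 2 by norm_num, Real.rpow_add hX0, Real.rpow_one,
      Real.sqrt_eq_rpow]
  set κ := ∑' d, densityTerm d with hκ
  set r := √X with hr
  -- The constants match because `π · (1/2) · (π/3) = ζ(2)`, giving the second factor `ζ(2)` of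
  -- `constA_eq`.
  have hA : constA * P / r
      = Real.pi ^ 2 / 6 * Real.pi / (X * Y) * (P / 2 * (Real.pi / 3 * Y * r * κ)) := by
    rw [constA_eq, ← hκ]
    field_simp
    rw [hr2]; ring
  have havg : classNumberAverage P X Y
      = Real.pi ^ 2 / 6 * Real.pi / (X * Y) * ∑ N ∈ levels P X Y, levelSum P N := by
    rw [classNumberAverage, hz]; rfl
  rw [havg, hA, ← mul_sub, abs_mul, abs_of_nonneg (by positivity)]
  set x := X ^ (1 / 12 : ℝ) with hx
  set y := Y ^ (1 / 6 : ℝ) with hy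
  set w := Y ^ (5 / 6 : ℝ) with hw
  have hx1 : 1 ≤ x := Real.one_le_rpow hX1 (by norm_num)
  have hw0 : 0 < w := by positivity
  have hwY : w ≤ Y := by
    calc w ≤ Y ^ (1 : ℝ) := Real.rpow_le_rpow_of_exponent_le hY (by norm_num)
      _ = Y := Real.rpow_one Y
  have hyw : y * w = Y := by
    rw [hy, hw, ← Real.rpow_add hY0]; norm_num
  -- The count yields the first power of `P`; it is weakened here to the exponent `7/6`.
  have hPP : (P : ℝ) ≤ (P : ℝ) ^ (7 / 6 : ℝ) := by
    calc (P : ℝ) = (P : ℝ) ^ (1 : ℝ) := (Real.rpow_one _).symm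
      _ ≤ _ := Real.rpow_le_rpow_of_exponent_le hP1 (by norm_num)
  set q := X ^ (min ε 1) with hq
  have hq1 : 1 ≤ q := Real.one_le_rpow hX1 (by positivity)
  have hqε : q ≤ (P * X * Y) ^ ε := by
    calc q ≤ X ^ ε := Real.rpow_le_rpow_of_exponent_le hX1 (min_le_left _ _)
      _ ≤ _ := by
        refine Real.rpow_le_rpow hX0.le ?_ hε.le
        calc X = 1 * X * 1 := by ring
          _ ≤ P * X * Y := by gcongr
  set T₂ := (P : ℝ) ^ (7 / 6 : ℝ) * x / w with hT₂
  have hT₂1 : P * x / w ≤ T₂ := by rw [hT₂]; gcongr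
  have hT₂2 : (P : ℝ) / (Y * r) ≤ T₂ := by
    refine le_trans ?_ hT₂1
    refine div_le_div₀ (by positivity) (le_mul_of_one_le_right (by positivity) hx1) hw0 ?_
    exact hwY.trans (le_mul_of_one_le_right hY0.le hr1)
  have hbound : 1 / (X * Y) * (Y * r + P * (q * (X * (x * y))) + P * (Y ^ 2 / r)
      + (Y + P) * (r * q)) ≤ 2 * ((1 / r + T₂ + P * Y / X ^ (3 / 2 : ℝ)) * q) := by
    have e : 1 / (X * Y) * (Y * r + P * (q * (X * (x * y))) + P * (Y ^ 2 / r)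
        + (Y + P) * (r * q)) = 1 / r + P * x / w * q + P * Y / X ^ (3 / 2 : ℝ) + 1 / r * q
          + P / (Y * r) * q := by
      have hy0 : y ≠ 0 := (Real.rpow_pos_of_pos hY0 _).ne'
      rw [hX32, ← hyw, ← hr2]
      field_simp
      ring
    rw [e]
    have b1 : 1 / r ≤ 1 / r * q := le_mul_of_one_le_right (by positivity) hq1
    have b2 : P * x / w * q ≤ T₂ * q := mul_le_mul_of_nonneg_right hT₂1 (by linarith)
    have b3 : P * Y / X ^ (3 / 2 : ℝ) ≤ P * Y / X ^ (3 / 2 : ℝ) * q :=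
      le_mul_of_one_le_right (by positivity) hq1
    have b4 : P / (Y * r) * q ≤ T₂ * q := mul_le_mul_of_nonneg_right hT₂2 (by linarith)
    have b5 : 0 ≤ P * Y / X ^ (3 / 2 : ℝ) * q := by positivity
    linarith
  calc _ ≤ Real.pi ^ 2 / 6 * Real.pi / (X * Y) * (C * (Y * r + P * (q * (X * (x * y)))
        + P * (Y ^ 2 / r) + (Y + P) * (r * q))) := mul_le_mul_of_nonneg_left hS (by positivity)
    _ = Real.pi ^ 3 / 6 * C * (1 / (X * Y) * (Y * r + P * (q * (X * (x * y)))
        + P * (Y ^ 2 / r) + (Y + P) * (r * q))) := by ring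
    _ ≤ Real.pi ^ 3 / 6 * C * (2 * ((1 / r + T₂ + P * Y / X ^ (3 / 2 : ℝ)) * q)) :=
        mul_le_mul_of_nonneg_left hbound (by positivity)
    _ = Real.pi ^ 3 / 6 * C * 2 * ((1 / r + T₂ + P * Y / X ^ (3 / 2 : ℝ)) * q) := by ring
    _ ≤ _ := by gcongr

theorem mainTheorem2 (ε : ℝ) (hε : 0 < ε) :
    ∃ C : ℝ, 0 < C ∧
      ∀ (ι : Type) (l : Filter ι) (P : ι → ℕ) (X Y : ι → ℝ),
        (∀ i, (P i).Prime ∧ P i ≠ 2) → (∀ i, 1 ≤ Y i) →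
        Tendsto X l atTop → Y =o[l] X →
        IsBigOWith C l
          (fun i => classNumberAverage (P i) (X i) (Y i) - constA * (P i : ℝ) / √(X i))
          (fun i =>
            (1 / √(X i)
              + (P i : ℝ) ^ (7 / 6 : ℝ) * (X i) ^ (1 / 12 : ℝ) / (Y i) ^ (5 / 6 : ℝ)
              + (P i : ℝ) * (Y i) / (X i) ^ (3 / 2 : ℝ))
            * ((P i : ℝ) * X i * Y i) ^ ε) := by
  obtain ⟨C, hC, h⟩ := exists_abs_classNumberAverage_sub_le hε
  refine ⟨C, hC, fun ι l P X Y hP hY hX hYX => ?_⟩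
  rw [isBigOWith_iff]
  -- Of `Y = o(X)` only the eventual inequality `Y ≤ X` is needed.
  filter_upwards [hX.eventually_ge_atTop 2, hYX.def one_pos] with i hXi hYXi
  have hY0 : 0 < Y i := lt_of_lt_of_le one_pos (hY i)
  have hX0 : 0 < X i := by linarith
  rw [one_mul, Real.norm_of_nonneg hY0.le, Real.norm_of_nonneg hX0.le] at hYXi
  rw [Real.norm_eq_abs]
  refine (h (P i) (X i) (Y i) (hP i).1 (hP i).2 hXi (hY i) hYXi).trans ?_
  exact mul_le_mul_of_nonneg_left (le_abs_self _) hC.le
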